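/- All compact spaces are Hausdorff. Let $\mathcal G$ be a Hausdorff topological groupoid with compact unit space $\mathcal G^{(0)}$, source map $s$ and range map $r$. A groupoid action $(K,q,\mathcal G)$ consists of a compact space $K$, a continuous open surjection $q\colon K\to\mathcal G^{(0)}$ with fibers $K_u=q^{-1}(u)$, and a continuous map $(g,x)\mapsto gx$, defined for $s(g)=q(x)$, with $q(gx)=r(g)$, $(gh)x=g(hx)$ whenever $s(g)=r(h)$ and $s(h)=q(x)$, and $ux=x$ for units $u=q(x)$. In particular $\mathcal G$ acts on $\mathcal G^{(0)}$ (with $q=\mathrm{id}$) by mapping $s(g)$ to $r(g)$. The action is *pseudoisometric* if there is a set $P$ of continuous maps $p\colon K\times_q K\to[0,\infty)$ which restrict to pseudometrics on each fiber $K_u$, such that these pseudometrics generate the topology of each $K_u$, and such that $p(gx,gy)=p(x,y)$ whenever $s(g)=q(x)=q(y)$. Let $\mathrm C_q^q(K,K)$ be the set of all continuous maps $\theta\colon K_u\to K_v$ ($u,v\in\mathcal G^{(0)}$; $s(\theta)=u$, $r(\theta)=v$), with composition $\theta\circ\eta$ defined when $s(\theta)=r(\eta)$, and with the topology generated by the sets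 $\{\theta : \theta(C\cap K_{s(\theta)})\subset O\}$ for $C\subset K$ compact and $O\subset K$ open. The *uniform enveloping semigroupoid* $\mathcal E_u(K,q,\mathcal G)$ is the smallest closed subset of $\mathrm C_q^q(K,K)$ that is stable under composition and contains all maps $K_{s(g)}\to K_{r(g)}$, $x\mapsto gx$, for $g\in\mathcal G$. It acts on $K$ by $(\theta,x)\mapsto\theta(x)$ for $s(\theta)=q(x)$. This action is *transitive* if $K\neq\emptyset$ and for all $x,y\in K$ some $\theta\in\mathcal E_u(K,q,\mathcal G)$ satisfies $\theta(x)=y$; it is *fiberwise transitive* if for every $u$ and all $x,y\in K_u$ some $\theta\in\mathcal E_u(K,q,\mathcal G)$ with $s(\theta)=r(\theta)=u$ satisfies $\theta(x)=y$. A morphism of groupoid actions $(K_1,q_1,\mathcal G_1)\to(K_2,q_2,\mathcal G_2)$ is a pair $(p,\Phi)$ of a continuous map $p\colon K_1\to K_2$ and a continuous groupoid homomorphism $\Phi\colon\mathcal G_1\to\mathcal G_2$ with $q_2\circ p=\Phi^{(0)}\circ q_1$ and $p(gx)=\Phi(g)p(x)$; it is a factor map if $p$ and $\Phi$ are surjective.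 A *trivial factor* of $(K,q,\mathcal G)$ is an action $(M,t,H)$, where $H$ is a compact space regarded as a groupoid consisting of units only, together with a factor map from $(K,q,\mathcal G)$ onto it; it is *maximal* if every factor map from $(K,q,\mathcal G)$ onto a trivial factor factors through it by a unique factor map. The action is *topologically ergodic* if for each of its trivial factors $(M,t,H)$ the space $M$ is a one-point space, and $\mathcal G$ is *topologically ergodic* if its action on $\mathcal G^{(0)}$ is. The action is *relatively topologically ergodic* if the canonical morphism, induced by $(q,\mathrm{id})$, from the maximal trivial factor of $(K,q,\mathcal G)$ to the maximal trivial factor of $(\mathcal G^{(0)},\mathrm{id},\mathcal G)$ is an isomorphism (where this includes that these maximal trivial factors exist). **Theorem.** Let $(K,q,\mathcal G)$ be a pseudoisometric groupoid action. Then $\mathcal E_u(K,q,\mathcal G)$ is compact and is a groupoid under composition (it contains the identity of each fiber and an inverse of each of its elements), and the following hold. 1. $(K,q,\mathcal G)$ is relatively topologically ergodic if and only if the action of $\mathcal E_u(K,q,\mathcal G)$ on $K$ is fiberwise transitive. 2. The following assertions are equivalent: (a) $(K,q,\mathcal G)$ is topologically ergodic; (b) $\mathcal G$ is topologically ergodic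 and $(K,q,\mathcal G)$ is relatively topologically ergodic; (c) the action of $\mathcal E_u(K,q,\mathcal G)$ on $K$ is transitive. -/

import Mathlib

open Set
open scoped NNReal

universe u v w u' v' w'

/-- A topological groupoid, with space of units `L` and Hausdorff space of arrows `G`. The unit space
is kept as a separate space, embedded in `G` by `unit` (which is a topological embedding, with
continuous left inverse `s`). Two arrows `g`, `h` are composable, with product `g h`, iff
`s g = r h`. -/
structure TopologicalGroupoid (L : Type w) (G : Type v) [TopologicalSpace L]
    [TopologicalSpace G] where
  t2 : T2Space G
  s : G → L
  r : G → L
  unit : L → G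
  inv : G → G
  mul : ∀ g h : G, s g = r h → G
  s_unit : ∀ a, s (unit a) = a
  r_unit : ∀ a, r (unit a) = a
  s_inv : ∀ g, s (inv g) = r g
  r_inv : ∀ g, r (inv g) = s g
  s_mul : ∀ g h (e : s g = r h), s (mul g h e) = s h
  r_mul : ∀ g h (e : s g = r h), r (mul g h e) = r g
  mul_assoc : ∀ g h k (e : s g = r h) (e' : s h = r k),
    mul (mul g h e) k ((s_mul g h e).trans e') = mul g (mul h k e') (e.trans (r_mul h k e').symm)
  mul_unit : ∀ g, mul g (unit (s g)) (r_unit (s g)).symm = g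
  unit_mul : ∀ g, mul (unit (r g)) g (s_unit (r g)) = g
  inv_mul : ∀ g, mul (inv g) g (s_inv g) = unit (s g)
  mul_inv : ∀ g, mul g (inv g) (r_inv g).symm = unit (r g)
  continuous_s : Continuous s
  continuous_r : Continuous r
  continuous_unit : Continuous unit
  continuous_inv : Continuous inv
  continuous_mul : Continuous fun z : {z : G × G // s z.1 = r z.2} => mul z.1.1 z.1.2 z.2

/-- The trivial groupoid of a compact space: all arrows are units. -/
def trivialGroupoid (H : Type w) [TopologicalSpace H] [CompactSpace H] [T2Space H] :
    TopologicalGroupoid H H where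
  t2 := inferInstance
  s := id
  r := id
  unit := id
  inv := id
  mul g _ _ := g
  s_unit _ := rfl
  r_unit _ := rfl
  s_inv _ := rfl
  r_inv _ := rfl
  s_mul _ _ e := e
  r_mul _ _ _ := rfl
  mul_assoc _ _ _ _ _ := rfl
  mul_unit _ := rfl
  unit_mul _ := rfl
  inv_mul _ := rfl
  mul_inv _ := rfl
  continuous_s := continuous_id
  continuous_r := continuous_id
  continuous_unit := continuous_id
  continuous_inv := continuous_id
  continuous_mul := continuous_fst.comp continuous_subtype_val

/-- A homomorphism of topological groupoids. -/
@[ext]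
structure TopologicalGroupoid.Hom {L : Type w} {G : Type v} [TopologicalSpace L]
    [TopologicalSpace G] {L' : Type w'} {G' : Type v'} [TopologicalSpace L'] [TopologicalSpace G']
    (𝒢 : TopologicalGroupoid L G) (ℋ : TopologicalGroupoid L' G') where
  toFun : G → G'
  continuous_toFun : Continuous toFun
  composable : ∀ g h, 𝒢.s g = 𝒢.r h → ℋ.s (toFun g) = ℋ.r (toFun h)
  map_mul : ∀ g h (e : 𝒢.s g = 𝒢.r h),
    toFun (𝒢.mul g h e) = ℋ.mul (toFun g) (toFun h) (composable g h e)

namespace TopologicalGroupoid.Hom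

variable {L : Type w} {G : Type v} [TopologicalSpace L] [TopologicalSpace G]
  {L' : Type w'} {G' : Type v'} [TopologicalSpace L'] [TopologicalSpace G']
  {𝒢 : TopologicalGroupoid L G} {ℋ : TopologicalGroupoid L' G'}

/-- The map induced by a homomorphism on unit spaces. -/
def onUnits (Φ : Hom 𝒢 ℋ) (a : L) : L' := ℋ.s (Φ.toFun (𝒢.unit a))

theorem s_toFun (Φ : Hom 𝒢 ℋ) (g : G) : ℋ.s (Φ.toFun g) = Φ.onUnits (𝒢.s g) := by
  conv_lhs => rw [← 𝒢.mul_unit g, Φ.map_mul, ℋ.s_mul]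
  rfl

end TopologicalGroupoid.Hom

/-- A (continuous) action `(K, q, 𝒢)` of a topological groupoid on a compact Hausdorff space `K`.
`act g x _` is `g x`, defined iff `s g = q x`. -/
structure GroupoidAction {L : Type w} {G : Type v} [TopologicalSpace L] [TopologicalSpace G]
    (𝒢 : TopologicalGroupoid L G) (K : Type u) [TopologicalSpace K] [CompactSpace K]
    [T2Space K] where
  q : K → L
  continuous_q : Continuous q
  isOpenMap_q : IsOpenMap q
  surjective_q : Function.Surjective q
  act : ∀ (g : G) (x : K), 𝒢.s g = q x → K
  continuous_act : Continuous fun z : {z : G × K // 𝒢.s z.1 = q z.2} => act z.1.1 z.1.2 z.2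
  q_act : ∀ g x (e : 𝒢.s g = q x), q (act g x e) = 𝒢.r g
  mul_act : ∀ g h (e : 𝒢.s g = 𝒢.r h) x (e' : 𝒢.s h = q x),
    act (𝒢.mul g h e) x ((𝒢.s_mul g h e).trans e') =
      act g (act h x e') (e.trans (q_act h x e').symm)
  unit_act : ∀ x, act (𝒢.unit (q x)) x (𝒢.s_unit (q x)) = x

/-- The canonical action of a groupoid with compact unit space on its unit space; `g` maps `s g`
to `r g`. -/
def TopologicalGroupoid.unitAction {L : Type w} {G : Type v} [TopologicalSpace L]
    [CompactSpace L] [T2Space L] [TopologicalSpace G] (𝒢 : TopologicalGroupoid L G) :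
    GroupoidAction 𝒢 L where
  q := id
  continuous_q := continuous_id
  isOpenMap_q := IsOpenMap.id
  surjective_q := Function.surjective_id
  act g _ _ := 𝒢.r g
  continuous_act := 𝒢.continuous_r.comp (continuous_fst.comp continuous_subtype_val)
  q_act _ _ _ := rfl
  mul_act g h e _ _ := 𝒢.r_mul g h e
  unit_act x := 𝒢.r_unit x

/-- A morphism `(p, Φ)` of groupoid actions, with `p` continuous (and not assumed to be open). -/
@[ext]
structure ActionMorphism {L : Type w} {G : Type v} [TopologicalSpace L] [TopologicalSpace G]
    {𝒢 : TopologicalGroupoid L G} {K : Type u} [TopologicalSpace K] [CompactSpace K] [T2Space K]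
    {L' : Type w'} {G' : Type v'} [TopologicalSpace L'] [TopologicalSpace G']
    {ℋ : TopologicalGroupoid L' G'} {M : Type u'} [TopologicalSpace M] [CompactSpace M]
    [T2Space M] (A : GroupoidAction 𝒢 K) (B : GroupoidAction ℋ M) where
  p : K → M
  continuous_p : Continuous p
  Φ : TopologicalGroupoid.Hom 𝒢 ℋ
  q_p : ∀ x, B.q (p x) = Φ.onUnits (A.q x)
  p_act : ∀ g x (e : 𝒢.s g = A.q x),
    p (A.act g x e) = B.act (Φ.toFun g) (p x)
      ((Φ.s_toFun g).trans ((congrArg Φ.onUnits e).trans (q_p x).symm))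

namespace ActionMorphism

variable {L : Type w} {G : Type v} [TopologicalSpace L] [TopologicalSpace G]
  {𝒢 : TopologicalGroupoid L G} {K : Type u} [TopologicalSpace K] [CompactSpace K] [T2Space K]
  {L' : Type w'} {G' : Type v'} [TopologicalSpace L'] [TopologicalSpace G']
  {ℋ : TopologicalGroupoid L' G'} {M : Type u'} [TopologicalSpace M] [CompactSpace M] [T2Space M]
  {A : GroupoidAction 𝒢 K} {B : GroupoidAction ℋ M}

/-- Factor maps (extensions): both components are surjective. -/
def IsFactorMap (f : ActionMorphism A B) : Prop :=
  Function.Surjective f.p ∧ Function.Surjective f.Φ.toFun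

/-- Isomorphisms: there is a morphism in the other direction that is inverse to `f` in both
components. -/
def IsIso (f : ActionMorphism A B) : Prop :=
  ∃ g : ActionMorphism B A,
    Function.LeftInverse g.p f.p ∧ Function.RightInverse g.p f.p ∧
    Function.LeftInverse g.Φ.toFun f.Φ.toFun ∧ Function.RightInverse g.Φ.toFun f.Φ.toFun

end ActionMorphism

namespace GroupoidAction

variable {L : Type w} {G : Type v} [TopologicalSpace L] [TopologicalSpace G]
  {𝒢 : TopologicalGroupoid L G} {K : Type u} [TopologicalSpace K] [CompactSpace K] [T2Space K]

/-- Topological ergodicity: every trivial factor is a point. -/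
def IsTopologicallyErgodic (A : GroupoidAction 𝒢 K) : Prop :=
  ∀ (M : Type u) (H : Type w) [TopologicalSpace M] [CompactSpace M] [T2Space M]
    [TopologicalSpace H] [CompactSpace H] [T2Space H]
    (B : GroupoidAction (trivialGroupoid H) M) (f : ActionMorphism A B),
    f.IsFactorMap → Nonempty (Unique M)

/-- The action `B` of the trivial groupoid of `H` on `M`, with the map `f` onto it, is a maximal
trivial factor of `A`: every factor map onto a trivial factor factors through `f` by a unique
factor map. -/
def IsMaximalTrivialFactor (A : GroupoidAction 𝒢 K) {M : Type u} {H : Type w}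
    [TopologicalSpace M] [CompactSpace M] [T2Space M] [TopologicalSpace H] [CompactSpace H]
    [T2Space H] (B : GroupoidAction (trivialGroupoid H) M) (f : ActionMorphism A B) : Prop :=
  f.IsFactorMap ∧
    ∀ (M' : Type u) (H' : Type w) [TopologicalSpace M'] [CompactSpace M'] [T2Space M']
      [TopologicalSpace H'] [CompactSpace H'] [T2Space H']
      (B' : GroupoidAction (trivialGroupoid H') M') (f' : ActionMorphism A B'),
      f'.IsFactorMap →
        ∃! m : ActionMorphism B B', m.IsFactorMap ∧
          (∀ x, m.p (f.p x) = f'.p x) ∧ (∀ g, m.Φ.toFun (f.Φ.toFun g) = f'.Φ.toFun g)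

/-- Relative topological ergodicity: the canonical morphism from the maximal trivial factor of
`(K, q, 𝒢)` to the maximal trivial factor of the action of `𝒢` on its unit space, i.e. the
morphism `α` with `α ∘ f = g ∘ (q, id)` for the maximal trivial factors `f` and `g`, is an
isomorphism. (Maximal trivial factors are unique up to isomorphism, and `α` is determined by `f`
and `g`.) -/
def IsRelativelyTopologicallyErgodic [CompactSpace L] [T2Space L]
    (A : GroupoidAction 𝒢 K) : Prop :=
  ∃ (M : Type u) (H : Type w) (_ : TopologicalSpace M) (_ : CompactSpace M) (_ : T2Space M)
    (_ : TopologicalSpace H) (_ : CompactSpace H) (_ : T2Space H)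
    (B : GroupoidAction (trivialGroupoid H) M) (f : ActionMorphism A B)
    (N : Type w) (J : Type w) (_ : TopologicalSpace N) (_ : CompactSpace N) (_ : T2Space N)
    (_ : TopologicalSpace J) (_ : CompactSpace J) (_ : T2Space J)
    (C : GroupoidAction (trivialGroupoid J) N) (g : ActionMorphism 𝒢.unitAction C)
    (α : ActionMorphism B C),
    A.IsMaximalTrivialFactor B f ∧ 𝒢.unitAction.IsMaximalTrivialFactor C g ∧
      (∀ x, α.p (f.p x) = g.p (A.q x)) ∧ (∀ a, α.Φ.toFun (f.Φ.toFun a) = g.Φ.toFun a) ∧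
      α.IsIso

end GroupoidAction

/-- A groupoid with compact unit space is topologically ergodic if its action on its unit space
is. -/
def TopologicalGroupoid.IsTopologicallyErgodic {L : Type w} {G : Type v} [TopologicalSpace L]
    [CompactSpace L] [T2Space L] [TopologicalSpace G] (𝒢 : TopologicalGroupoid L G) : Prop :=
  𝒢.unitAction.IsTopologicallyErgodic

/-- An element of the space `C_q^q(K, K)` of continuous fiber maps of `q : K → L`: a continuous map
from a fiber `K_src` to a fiber `K_tgt`. -/
structure FiberMap {K : Type u} {L : Type w} [TopologicalSpace K] (q : K → L) where
  src : L
  tgt : L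
  map : C({x : K // q x = src}, {x : K // q x = tgt})

namespace FiberMap

variable {K : Type u} {L : Type w} [TopologicalSpace K] {q : K → L}

/-- The subbasic set `W(C, O)` of fiber maps `θ` with `θ(C ∩ K_{s(θ)}) ⊆ O`. -/
def W (q : K → L) (C O : Set K) : Set (FiberMap q) :=
  {θ | ∀ x : {x : K // q x = θ.src}, (x : K) ∈ C → (θ.map x : K) ∈ O}

/-- The compact-open topology on the space of fiber maps. -/
instance compactOpenTopology : TopologicalSpace (FiberMap q) :=
  TopologicalSpace.generateFrom {S | ∃ C O : Set K, IsCompact C ∧ IsOpen O ∧ S = W q C O}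

/-- The composition `θ ∘ η`, defined iff `s(θ) = r(η)`. -/
def comp (θ η : FiberMap q) (e : θ.src = η.tgt) : FiberMap q where
  src := η.src
  tgt := θ.tgt
  map :=
    { toFun := fun x => θ.map ⟨η.map x, (η.map x).2.trans e.symm⟩
      continuous_toFun := by fun_prop }

/-- The identity of the fiber `K_l`. -/
def idOn (q : K → L) (l : L) : FiberMap q where
  src := l
  tgt := l
  map := ContinuousMap.id _

/-- A set of fiber maps is a subsemigroupoid if it is stable under composition. -/
def IsSubsemigroupoid (S : Set (FiberMap q)) : Prop :=
  ∀ θ ∈ S, ∀ η ∈ S, ∀ e : θ.src = η.tgt, comp θ η e ∈ S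

/-- A subsemigroupoid of the semigroupoid of fiber maps that is a groupoid with all identities
of fibers as its units: it contains all these identities, and an inverse for each element. -/
def IsFullGroupoid (S : Set (FiberMap q)) : Prop :=
  IsSubsemigroupoid S ∧ (∀ l, idOn q l ∈ S) ∧
    ∀ θ ∈ S, ∃ η ∈ S, ∃ (e : η.src = θ.tgt) (e' : θ.src = η.tgt),
      comp η θ e = idOn q θ.src ∧ comp θ η e' = idOn q θ.tgt

/-- The uniform enveloping semigroupoid of a set of fiber maps: the smallest closed
subsemigroupoid that contains it. -/
def envelope (F : Set (FiberMap q)) : Set (FiberMap q) :=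
  ⋂₀ {S | IsClosed S ∧ IsSubsemigroupoid S ∧ F ⊆ S}

/-- The orbit of `x` under a (semi)groupoid `S` of fiber maps. -/
def orbit (S : Set (FiberMap q)) (x : K) : Set K :=
  {y | ∃ θ ∈ S, ∃ e : q x = θ.src, (θ.map ⟨x, e⟩ : K) = y}

/-- Transitivity of the action of a groupoid `S` of fiber maps on the (non-empty) space `K`. -/
def IsTransitive (S : Set (FiberMap q)) : Prop :=
  Nonempty K ∧ ∀ x : K, orbit S x = univ

/-- Fiberwise transitivity of the action of a groupoid `S` of fiber maps on `K`: for each unit `l`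
the isotropy group `S_l^l` acts transitively on the fiber `K_l`. -/
def IsFiberwiseTransitive (S : Set (FiberMap q)) : Prop :=
  ∀ (l : L) (x y : {x : K // q x = l}), ∃ θ ∈ S, ∃ e : l = θ.src, l = θ.tgt ∧
    (θ.map ⟨x, x.2.trans e⟩ : K) = y

end FiberMap

namespace GroupoidAction

variable {L : Type w} {G : Type v} [TopologicalSpace L] [TopologicalSpace G]
  {𝒢 : TopologicalGroupoid L G} {K : Type u} [TopologicalSpace K] [CompactSpace K] [T2Space K]

/-- The fiber map `φ_g : K_{s(g)} → K_{r(g)}`, `x ↦ g x`. -/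
def transition (A : GroupoidAction 𝒢 K) (g : G) : FiberMap A.q where
  src := 𝒢.s g
  tgt := 𝒢.r g
  map :=
    { toFun := fun x => ⟨A.act g x x.2.symm, A.q_act g x x.2.symm⟩
      continuous_toFun := by
        refine Continuous.subtype_mk (A.continuous_act.comp
          (f := fun x : {x : K // A.q x = 𝒢.s g} =>
            (⟨(g, (x : K)), x.2.symm⟩ : {z : G × K // 𝒢.s z.1 = A.q z.2})) ?_) _
        fun_prop }

/-- The uniform enveloping semigroupoid of a groupoid action. -/
def uniformEnvelope (A : GroupoidAction 𝒢 K) : Set (FiberMap A.q) :=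
  FiberMap.envelope (range A.transition)

/-- Pseudoisometric actions: there is a set `P` of continuous functions `K ×_q K → [0, ∞)` that are
invariant and restrict to pseudometrics on each fiber, and these pseudometrics generate the
topology of each fiber. -/
def IsPseudoisometric (A : GroupoidAction 𝒢 K) : Prop :=
  ∃ P : Set C({z : K × K // A.q z.1 = A.q z.2}, ℝ≥0),
    (∀ p ∈ P,
      (∀ x, p ⟨(x, x), rfl⟩ = 0) ∧
      (∀ x y (e : A.q x = A.q y), p ⟨(x, y), e⟩ = p ⟨(y, x), e.symm⟩) ∧
      (∀ x y z (e : A.q x = A.q y) (e' : A.q y = A.q z),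
        p ⟨(x, z), e.trans e'⟩ ≤ p ⟨(x, y), e⟩ + p ⟨(y, z), e'⟩)) ∧
    (∀ l : L, (instTopologicalSpaceSubtype : TopologicalSpace {x : K // A.q x = l}) =
      TopologicalSpace.generateFrom
        {U | ∃ p ∈ P, ∃ (x : {x : K // A.q x = l}) (ε : ℝ≥0), 0 < ε ∧
          U = {y : {x : K // A.q x = l} | p ⟨(x, y), x.2.trans y.2.symm⟩ < ε}}) ∧
    (∀ p ∈ P, ∀ g x y (ex : 𝒢.s g = A.q x) (ey : 𝒢.s g = A.q y),
      p ⟨(A.act g x ex, A.act g y ey), (A.q_act g x ex).trans (A.q_act g y ey).symm⟩ =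
        p ⟨(x, y), ex.symm.trans ey⟩)

end GroupoidAction

open Filter Topology

/-! ### Quotients of compact Hausdorff spaces by closed equivalence relations -/

/-! Fiber maps are handled through their graphs, and limits of fiber maps through ultrafilter limits
of graphs. The pseudometrics `P` separate the points of each fiber, and every map `x ↦ g x` is a
surjective `P`-isometry between fibers. Along an ultrafilter of such isometries, the limit of the
graphs is a closed relation that still preserves `P`, hence is functional; since `q` is open, it has
full domain and range over the limiting units. It is therefore the graph of a surjective isometry,
to which the ultrafilter converges (`exists_limit_surjIsometries`). So the surjective isometries
form a compact closed subsemigroupoid, and the envelope is compact. Inversion swaps coordinates of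
graphs and commutes with these limits, so having an inverse in the envelope passes from the
generators to the whole envelope (`isFullGroupoid_envelope`).

The orbit relation on `K` is then an equivalence relation, closed by compactness, and so is its
image on the unit space `L`; both quotients are Hausdorff, and `q` induces an open surjection
between them. A continuous map to a Hausdorff space that is invariant under the groupoid is
invariant under the envelope, because `f x = f y` is a closed transitive relation
(`graph_subset_of_mem_envelope`). Hence the two quotients are the maximal trivial factors of `K` and
`L`. Ergodicity says that the orbit quotient is a point, relative ergodicity that the induced map of
quotients is injective, and the theorem becomes a statement about the two equivalence relations. -/

/-- The saturation of a closed set is a projection of a compact set, so the quotient map is closed.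
Distinct classes are disjoint closed sets; normality separates them, and closedness of the map
pushes the separation down to the quotient. -/
theorem t2Space_quotient_of_isClosed {X : Type*} [TopologicalSpace X] [CompactSpace X] [T2Space X]
    (r : Setoid X) (hr : IsClosed {z : X × X | r z.1 z.2}) : T2Space (Quotient r) := by
  have hmk : IsClosedMap (Quotient.mk r) := by
    intro C hC
    rw [← isQuotientMap_quotient_mk'.isClosed_preimage]
    have : Quotient.mk' ⁻¹' (Quotient.mk r '' C) =
        Prod.snd '' ({z : X × X | r z.1 z.2} ∩ Prod.fst ⁻¹' C) := by
      ext y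
      simp only [mem_preimage, mem_image, mem_inter_iff, mem_ofPred_eq, Prod.exists,
        exists_eq_right]
      refine exists_congr fun x => ⟨fun h => ⟨Quotient.exact h.2, h.1⟩,
        fun h => ⟨h.2, Quotient.sound h.1⟩⟩
    rw [this]
    exact ((hr.inter (hC.preimage continuous_fst)).isCompact.image continuous_snd).isClosed
  have hcl : ∀ a : Quotient r, IsClosed (Quotient.mk r ⁻¹' {a}) := by
    intro a
    obtain ⟨x, rfl⟩ := Quotient.exists_rep a
    have : Quotient.mk r ⁻¹' {⟦x⟧} = (fun y => (y, x)) ⁻¹' {z : X × X | r z.1 z.2} := by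
      ext y
      exact ⟨fun h => Quotient.exact h, fun h => Quotient.sound h⟩
    rw [this]
    exact hr.preimage (by fun_prop)
  refine ⟨fun a b hab => ?_⟩
  have hd : Disjoint (Quotient.mk r ⁻¹' {a}) (Quotient.mk r ⁻¹' {b}) :=
    Disjoint.preimage _ (disjoint_singleton.2 hab)
  obtain ⟨U, V, hU, hV, haU, hbV, hUV⟩ := normal_separation (hcl a) (hcl b) hd
  refine ⟨(Quotient.mk r '' Uᶜ)ᶜ, (Quotient.mk r '' Vᶜ)ᶜ, (hmk _ hU.isClosed_compl).isOpen_compl,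
    (hmk _ hV.isClosed_compl).isOpen_compl, ?_, ?_, ?_⟩
  · rintro ⟨x, hx, rfl⟩
    exact hx (haU rfl)
  · rintro ⟨x, hx, rfl⟩
    exact hx (hbV rfl)
  · rw [Set.disjoint_left]
    intro c hc hc'
    obtain ⟨x, rfl⟩ := Quotient.exists_rep c
    have h1 : x ∈ U := by
      by_contra h
      exact hc ⟨x, h, rfl⟩
    have h2 : x ∈ V := by
      by_contra h
      exact hc' ⟨x, h, rfl⟩
    exact Set.disjoint_left.1 hUV h1 h2

/-! ### Limits of families of sets along ultrafilters -/

/-- The set of limits of points of the sets `g i` along the ultrafilter `𝒰`. -/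
def Ultrafilter.limSet {ι X : Type*} [TopologicalSpace X] (𝒰 : Ultrafilter ι) (g : ι → Set X) :
    Set X :=
  {z | ∀ N ∈ 𝓝 z, ∀ᶠ i in 𝒰, (N ∩ g i).Nonempty}

namespace Ultrafilter

variable {ι X Y : Type*} [TopologicalSpace X] [TopologicalSpace Y] {𝒰 : Ultrafilter ι}
  {g : ι → Set X}

theorem isClosed_limSet : IsClosed (𝒰.limSet g) := by
  rw [← closure_subset_iff_isClosed]
  intro z hz N hN
  obtain ⟨O, hON, hO, hzO⟩ := mem_nhds_iff.1 hN
  obtain ⟨z', hz'O, hz'⟩ := mem_closure_iff.1 hz O hO hzO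
  filter_upwards [hz' O (hO.mem_nhds hz'O)] with i hi
  exact hi.mono (inter_subset_inter_left _ hON)

/-- If no point of `C` were a limit, each would have a neighbourhood that misses `g i` eventually,
because an ultrafilter turns "not eventually" into "eventually not". Finitely many of these
neighbourhoods cover `C`. -/
theorem inter_limSet_nonempty {C : Set X} (hC : IsCompact C)
    (h : ∀ᶠ i in 𝒰, (C ∩ g i).Nonempty) : (C ∩ 𝒰.limSet g).Nonempty := by
  by_contra hne
  have : ∀ᶠ i in 𝒰, ¬ (C ∩ g i).Nonempty := by
    refine hC.induction_on (p := fun s => ∀ᶠ i in 𝒰, ¬ (s ∩ g i).Nonempty) (by simp) ?_ ?_ ?_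
    · intro s t hst ht
      filter_upwards [ht] with i hi h'
      exact hi (h'.mono (inter_subset_inter_left _ hst))
    · intro s t hs ht
      filter_upwards [hs, ht] with i hi hi'
      rintro ⟨z, hz | hz, hzi⟩
      exacts [hi ⟨z, hz, hzi⟩, hi' ⟨z, hz, hzi⟩]
    · intro z hz
      have hz' : z ∉ 𝒰.limSet g := fun h' => hne ⟨z, hz, h'⟩
      simp only [limSet, mem_ofPred_eq, not_forall, exists_prop] at hz'
      obtain ⟨N, hN, hN'⟩ := hz'
      exact ⟨N, mem_nhdsWithin_of_mem_nhds hN, Ultrafilter.eventually_not.2 hN'⟩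
  obtain ⟨i, hi, hi'⟩ := (h.and this).exists
  exact hi' hi

theorem limSet_subset_of_isClosed {T : Set X} (hT : IsClosed T) (h : ∀ᶠ i in 𝒰, g i ⊆ T) :
    𝒰.limSet g ⊆ T := by
  intro z hz
  by_contra hzT
  obtain ⟨i, ⟨z', hz', hi⟩, hi'⟩ := ((hz _ (hT.isOpen_compl.mem_nhds hzT)).and h).exists
  exact hz' (hi' hi)

/-- Limit points are approximated eventually, not just frequently, so two of them can be
approximated at one common index. This passes conditions on pairs of points of `g i`, such as
isometry, to the limit. -/
theorem limSet_prod_subset_of_isClosed {T : Set (X × X)} (hT : IsClosed T)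
    (h : ∀ᶠ i in 𝒰, g i ×ˢ g i ⊆ T) : 𝒰.limSet g ×ˢ 𝒰.limSet g ⊆ T := by
  rintro ⟨z, z'⟩ ⟨hz, hz'⟩
  by_contra hzT
  obtain ⟨N, hN, N', hN', hNN⟩ := mem_nhds_prod_iff.1 (hT.isOpen_compl.mem_nhds hzT)
  obtain ⟨i, ⟨⟨a, ha, hai⟩, ⟨b, hb, hbi⟩⟩, hi'⟩ := (((hz _ hN).and (hz' _ hN')).and h).exists
  exact hNN (mk_mem_prod ha hb) (hi' (mk_mem_prod hai hbi))

theorem eq_of_mem_limSet [T2Space Y] {f : X → Y} (hf : Continuous f) {c : ι → Y} {a : Y}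
    (hc : Tendsto c 𝒰 (𝓝 a)) (hfc : ∀ i, ∀ z ∈ g i, f z = c i) {z : X}
    (hz : z ∈ 𝒰.limSet g) : f z = a := by
  by_contra hne
  obtain ⟨U, V, hU, hV, hzU, haV, hUV⟩ := t2_separation hne
  obtain ⟨i, ⟨z', hz', hi⟩, hi'⟩ := ((hz _ ((hU.preimage hf).mem_nhds hzU)).and
    (hc (hV.mem_nhds haV))).exists
  have : f z' ∈ U := hz'
  rw [hfc i z' hi] at this
  exact Set.disjoint_left.1 hUV this hi'

/-- If the images of the sets `g i` under `f` contain points close to `a`, for instance if these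
images are fibers of an open map, then `a` belongs to the image of the limit set. -/
theorem mem_image_limSet [CompactSpace X] [T2Space Y] [RegularSpace Y] {f : X → Y}
    (hf : Continuous f) {a : Y} (h : ∀ N ∈ 𝓝 a, ∀ᶠ i in 𝒰, ∃ z ∈ g i, f z ∈ N) :
    ∃ z ∈ 𝒰.limSet g, f z = a := by
  have hcl : IsClosed (f '' 𝒰.limSet g) :=
    (isClosed_limSet.isCompact.image hf).isClosed
  suffices a ∈ closure (f '' 𝒰.limSet g) by
    rw [hcl.closure_eq] at this
    exact this
  rw [mem_closure_iff_nhds]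
  intro N hN
  obtain ⟨N', hN', hcN', hNN'⟩ := exists_mem_nhds_isClosed_subset hN
  obtain ⟨z, hz, hz'⟩ := inter_limSet_nonempty (𝒰 := 𝒰) (g := g)
    (hcN'.preimage hf).isCompact (by
      filter_upwards [h N' hN'] with i hi
      obtain ⟨z, hz, hzN⟩ := hi
      exact ⟨z, hzN, hz⟩)
  exact ⟨f z, hNN' hz, mem_image_of_mem f hz'⟩

theorem limSet_preimage_homeomorph (e : X ≃ₜ Y) (g : ι → Set Y) :
    𝒰.limSet (fun i => e ⁻¹' g i) = e ⁻¹' 𝒰.limSet g := by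
  ext z
  simp only [limSet, mem_ofPred_eq, mem_preimage]
  constructor
  · intro h N hN
    filter_upwards [h _ (e.continuous.continuousAt hN)] with i hi
    obtain ⟨z', hz', hi⟩ := hi
    exact ⟨e z', hz', hi⟩
  · intro h N hN
    have hN' : e.symm ⁻¹' N ∈ 𝓝 (e z) :=
      e.symm.continuous.continuousAt (by rwa [e.symm_apply_apply])
    filter_upwards [h _ hN'] with i hi
    obtain ⟨y, hy, hi⟩ := hi
    exact ⟨e.symm y, hy, by simpa using hi⟩

end Ultrafilter

/-! ### Fiber maps and their graphs -/

namespace FiberMap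

variable {K : Type u} {L : Type w} [TopologicalSpace K] {q : K → L}

/-- The graph of a fiber map. -/
def graph (θ : FiberMap q) : Set (K × K) :=
  {z | ∃ e : q z.1 = θ.src, (θ.map ⟨z.1, e⟩ : K) = z.2}

theorem mk_mem_graph (θ : FiberMap q) (x : {x : K // q x = θ.src}) :
    ((x : K), (θ.map x : K)) ∈ θ.graph := ⟨x.2, rfl⟩

theorem q_fst {θ : FiberMap q} {z : K × K} (hz : z ∈ θ.graph) : q z.1 = θ.src := hz.1

theorem q_snd {θ : FiberMap q} {z : K × K} (hz : z ∈ θ.graph) : q z.2 = θ.tgt := by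
  obtain ⟨e, h⟩ := hz
  rw [← h]
  exact (θ.map _).2

theorem graph_functional {θ : FiberMap q} {x y y' : K} (h : (x, y) ∈ θ.graph)
    (h' : (x, y') ∈ θ.graph) : y = y' := by
  obtain ⟨e, h⟩ := h
  obtain ⟨e', h'⟩ := h'
  exact h.symm.trans h'

/-- Fibers are nonempty, so a graph determines source and target; once these agree, inclusion of
graphs of functions on the same domain is equality. -/
theorem eq_of_graph_subset (hq : Function.Surjective q) {θ η : FiberMap q}
    (h : θ.graph ⊆ η.graph) : θ = η := by
  obtain ⟨x, hx⟩ := hq θ.src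
  have h0 := θ.mk_mem_graph ⟨x, hx⟩
  have hs : θ.src = η.src := (q_fst h0).symm.trans (q_fst (h h0))
  have ht : θ.tgt = η.tgt := (q_snd h0).symm.trans (q_snd (h h0))
  obtain ⟨s, t, f⟩ := θ
  obtain ⟨s', t', f'⟩ := η
  dsimp only at hs ht
  subst hs ht
  congr 1
  ext y
  obtain ⟨e, h1⟩ := h (mk_mem_graph _ y)
  exact h1.symm

theorem graph_comp (θ η : FiberMap q) (e : θ.src = η.tgt) :
    (comp θ η e).graph = {z | ∃ y, (z.1, y) ∈ η.graph ∧ (y, z.2) ∈ θ.graph} := by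
  ext ⟨x, y⟩
  constructor
  · rintro ⟨e', h⟩
    exact ⟨_, η.mk_mem_graph ⟨x, e'⟩, ⟨(η.map ⟨x, e'⟩).2.trans e.symm, h⟩⟩
  · rintro ⟨a, ⟨e1, h1⟩, ⟨e2, h2⟩⟩
    dsimp only at e1 h1 e2 h2
    subst h1
    exact ⟨e1, h2⟩

theorem graph_idOn (l : L) : (idOn q l).graph = {z | q z.1 = l ∧ z.1 = z.2} := by
  ext ⟨x, y⟩
  exact ⟨fun ⟨e, h⟩ => ⟨e, h⟩, fun ⟨e, h⟩ => ⟨e, h⟩⟩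

theorem isOpen_W {C O : Set K} (hC : IsCompact C) (hO : IsOpen O) : IsOpen (W q C O) :=
  TopologicalSpace.isOpen_generateFrom_of_mem ⟨C, O, hC, hO, rfl⟩

theorem isClosed_envelope (F : Set (FiberMap q)) : IsClosed (envelope F) :=
  isClosed_sInter fun _ h => h.1

theorem isSubsemigroupoid_envelope (F : Set (FiberMap q)) : IsSubsemigroupoid (envelope F) :=
  fun θ hθ η hη e S hS => hS.2.1 θ (hθ S hS) η (hη S hS) e

theorem subset_envelope (F : Set (FiberMap q)) : F ⊆ envelope F :=
  subset_sInter fun _ h => h.2.2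

theorem envelope_subset {F S : Set (FiberMap q)} (hc : IsClosed S) (hS : IsSubsemigroupoid S)
    (hF : F ⊆ S) : envelope F ⊆ S :=
  sInter_subset_of_mem ⟨hc, hS, hF⟩

/-! ### Surjective isometries between fibers -/

/-- Pairs of pairs with the same values under all functions of the set `P`. -/
def equidistant (P : Set C({z : K × K // q z.1 = q z.2}, ℝ≥0)) : Set ((K × K) × (K × K)) :=
  {w | ∃ (e : q w.1.1 = q w.2.1) (e' : q w.1.2 = q w.2.2), ∀ p ∈ P,
    p ⟨(w.1.1, w.2.1), e⟩ = p ⟨(w.1.2, w.2.2), e'⟩}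

/-- The set of surjective fiber maps that preserve all functions of the set `P`. -/
def surjIsometries (P : Set C({z : K × K // q z.1 = q z.2}, ℝ≥0)) : Set (FiberMap q) :=
  {θ | θ.graph ×ˢ θ.graph ⊆ equidistant P ∧ ∀ y, q y = θ.tgt → ∃ x, (x, y) ∈ θ.graph}

/-- The functions of the set `P` vanish on the diagonal and separate the points of fibers. -/
def Separates (P : Set C({z : K × K // q z.1 = q z.2}, ℝ≥0)) : Prop :=
  ∀ x y (e : q x = q y), x = y ↔ ∀ p ∈ P, p ⟨(x, y), e⟩ = 0

variable {P : Set C({z : K × K // q z.1 = q z.2}, ℝ≥0)}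

theorem Separates.eq_iff (hP : Separates P) {x y x' y' : K}
    (h : ((x, y), (x', y')) ∈ equidistant P) : x = x' ↔ y = y' := by
  obtain ⟨e, e', h⟩ := h
  rw [hP x x' e, hP y y' e']
  exact forall₂_congr fun p hp => by rw [h p hp]

theorem isSubsemigroupoid_surjIsometries : IsSubsemigroupoid (surjIsometries P) := by
  rintro θ ⟨hθ, hθ'⟩ η ⟨hη, hη'⟩ e
  constructor
  · rw [graph_comp]
    rintro ⟨⟨x, z⟩, ⟨x', z'⟩⟩ ⟨⟨y, h1, h2⟩, ⟨y', h1', h2'⟩⟩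
    obtain ⟨e1, e2, h⟩ := hη (mk_mem_prod h1 h1')
    obtain ⟨e3, e4, h'⟩ := hθ (mk_mem_prod h2 h2')
    exact ⟨e1, e4, fun p hp => (h p hp).trans (h' p hp)⟩
  · intro z hz
    obtain ⟨y, hy⟩ := hθ' z hz
    obtain ⟨x, hx⟩ := hη' y ((q_fst hy).trans e)
    refine ⟨x, ?_⟩
    rw [graph_comp]
    exact ⟨y, hx, hy⟩

/-- If the limit of the graphs is the graph of a fiber map, then the fiber maps converge. -/
theorem le_nhds_of_limSet_subset [CompactSpace K] [T2Space K] {𝒰 : Ultrafilter (FiberMap q)}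
    {θ : FiberMap q} (h : 𝒰.limSet graph ⊆ θ.graph) : (𝒰 : Filter (FiberMap q)) ≤ 𝓝 θ := by
  rw [TopologicalSpace.nhds_generateFrom]
  refine le_iInf₂ fun S hS => ?_
  obtain ⟨hθ, C, O, hC, hO, rfl⟩ := hS
  rw [le_principal_iff]
  by_contra hn
  -- A map outside `W q C O` has a graph point in the compact set `C ×ˢ Oᶜ`, so the limit of the
  -- graphs has one too, which contradicts `θ ∈ W q C O`.
  have hn' : ∀ᶠ η : FiberMap q in 𝒰, ((C ×ˢ Oᶜ) ∩ graph η).Nonempty := by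
    filter_upwards [Ultrafilter.eventually_not.2 hn] with η hη
    have : ¬ ∀ x : {x : K // q x = η.src}, (x : K) ∈ C → (η.map x : K) ∈ O := hη
    push Not at this
    obtain ⟨x, hx, hx'⟩ := this
    exact ⟨_, mk_mem_prod hx hx', η.mk_mem_graph x⟩
  obtain ⟨⟨x, y⟩, ⟨hx, hy⟩, hxy⟩ :=
    Ultrafilter.inter_limSet_nonempty (hC.prod hO.isClosed_compl.isCompact) hn'
  obtain ⟨e, hxy⟩ := h hxy
  dsimp only at e hxy hx hy
  have := hθ ⟨x, e⟩ hx
  rw [hxy] at this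
  exact hy this

variable [TopologicalSpace L]

/-- A closed functional relation between two fibers is the graph of a fiber map. -/
theorem exists_graph_eq [CompactSpace K] [T2Space K] [T1Space L] (hq : Continuous q)
    {Γ : Set (K × K)} (hΓ : IsClosed Γ) {a b : L} (hab : ∀ z ∈ Γ, q z.1 = a ∧ q z.2 = b)
    (hex : ∀ x, q x = a → ∃ y, (x, y) ∈ Γ)
    (hfun : ∀ x y y', (x, y) ∈ Γ → (x, y') ∈ Γ → y = y') :
    ∃ θ : FiberMap q, θ.src = a ∧ θ.tgt = b ∧ θ.graph = Γ := by
  choose! f hf using hex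
  have : CompactSpace {x : K // q x = b} :=
    isCompact_iff_compactSpace.1 ((isClosed_singleton (x := b)).preimage hq).isCompact
  let F : {x : K // q x = a} → {x : K // q x = b} := fun x => ⟨f x, (hab _ (hf x x.2)).2⟩
  have hF : Continuous F := by
    refine continuous_iff_isClosed.2 fun D hD => ?_
    have hD' : IsClosed (Subtype.val '' D) := (hD.isCompact.image continuous_subtype_val).isClosed
    -- The closed graph argument: the preimage of a closed set is a projection of a compact part of
    -- `Γ`.
    have h : F ⁻¹' D = Subtype.val ⁻¹' (Prod.fst '' (Γ ∩ Prod.snd ⁻¹' (Subtype.val '' D))) := by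
      ext x
      constructor
      · intro hx
        exact ⟨(x, f x), ⟨hf x x.2, ⟨F x, hx, rfl⟩⟩, rfl⟩
      · rintro ⟨⟨x', y⟩, ⟨hxy, ⟨d, hd, hdy⟩⟩, hx'⟩
        dsimp only at hx' hdy
        subst hx' hdy
        have : F x = d := Subtype.ext (hfun _ _ _ (hf x x.2) hxy)
        rwa [mem_preimage, this]
    rw [h]
    exact ((hΓ.inter (hD'.preimage continuous_snd)).isCompact.image continuous_fst).isClosed.preimage
      continuous_subtype_val
  refine ⟨⟨a, b, ⟨F, hF⟩⟩, rfl, rfl, ?_⟩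
  ext ⟨x, y⟩
  constructor
  · rintro ⟨e, h⟩
    dsimp only at e h
    rw [← h]
    exact hf x e
  · intro h
    exact ⟨(hab _ h).1, hfun _ _ _ (hf x (hab _ h).1) h⟩

/-! ### Limits of fiber maps -/

/-- Membership in `W q C ∅` says that the source fiber misses `C`. With `C = q ⁻¹' Vᶜ` this means
that the source lies in `V`; surjectivity of `q` rules out an empty fiber satisfying it vacuously.
-/
theorem continuous_src [CompactSpace K] (hq : Continuous q) (hs : Function.Surjective q) :
    Continuous (src : FiberMap q → L) := by
  refine continuous_def.2 fun V hV => ?_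
  have : src ⁻¹' V = W q (q ⁻¹' Vᶜ) ∅ := by
    ext θ
    constructor
    · intro h x hx
      have : q x ∉ V := hx
      rw [x.2] at this
      exact this h
    · intro h
      obtain ⟨x, hx⟩ := hs θ.src
      by_contra hV'
      have hx' : q x ∉ V := by rwa [hx]
      exact h ⟨x, hx⟩ hx'
  rw [this]
  exact isOpen_W (hV.isClosed_compl.preimage hq).isCompact isOpen_empty

/-- The graph of a limit of fiber maps is contained in the limit of the graphs. -/
theorem graph_subset_limSet [CompactSpace K] [T2Space K] (hq : Continuous q) (ho : IsOpenMap q)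
    (hs : Function.Surjective q) {𝒰 : Ultrafilter (FiberMap q)} {θ : FiberMap q}
    (h𝒰 : (𝒰 : Filter (FiberMap q)) ≤ 𝓝 θ) : θ.graph ⊆ 𝒰.limSet graph := by
  rintro ⟨x, y⟩ ⟨e, hxy⟩ N hN
  dsimp only at e hxy
  obtain ⟨N₁, hN₁, N₂, hN₂, hN⟩ := mem_nhds_prod_iff.1 hN
  obtain ⟨O₂, hON₂, hO₂, hyO₂⟩ := mem_nhds_iff.1 hN₂
  obtain ⟨O, hO, hO'⟩ := isOpen_induced_iff.1
    (hO₂.preimage (continuous_subtype_val.comp θ.map.continuous))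
  have hxO : x ∈ O := by
    have : (⟨x, e⟩ : {x : K // q x = θ.src}) ∈ Subtype.val ⁻¹' O := by
      rw [hO']
      change (θ.map ⟨x, e⟩ : K) ∈ O₂
      rwa [hxy]
    exact this
  obtain ⟨C, hC, hcC, hCO⟩ := exists_mem_nhds_isClosed_subset
    (Filter.inter_mem (hO.mem_nhds hxO) hN₁)
  have hW : θ ∈ W q C O₂ := by
    intro x' hx'
    have : x' ∈ Subtype.val ⁻¹' O := (hCO hx').1
    rw [hO'] at this
    exact this
  -- Membership in `W q C O₂` is vacuous for maps whose source fiber misses `C`. Openness of `q`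
  -- makes `q '' C` a neighbourhood of the source, so nearby maps do have a point of `C` in their
  -- domain.
  have hsrc : src ⁻¹' (q '' C) ∈ 𝓝 θ :=
    (continuous_src hq hs).continuousAt (by
      rw [← e]
      exact ho.image_mem_nhds hC)
  filter_upwards [h𝒰 ((isOpen_W hcC.isCompact hO₂).mem_nhds hW), h𝒰 hsrc] with η hη hη'
  obtain ⟨x', hx', e'⟩ := hη'
  exact ⟨_, hN (mk_mem_prod (hCO hx').2 (hON₂ (hη ⟨x', e'⟩ hx'))), η.mk_mem_graph ⟨x', e'⟩⟩

/-- A closed transitive relation contains the graphs of all elements of an envelope if it contains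
those of the generators. -/
theorem graph_subset_of_mem_envelope [CompactSpace K] [T2Space K] (hq : Continuous q)
    (ho : IsOpenMap q) (hs : Function.Surjective q) {F : Set (FiberMap q)} {T : Set (K × K)}
    (hT : IsClosed T) (htrans : ∀ x y z, (x, y) ∈ T → (y, z) ∈ T → (x, z) ∈ T)
    (hF : ∀ θ ∈ F, θ.graph ⊆ T) {θ : FiberMap q} (hθ : θ ∈ envelope F) : θ.graph ⊆ T := by
  refine hθ {θ | θ.graph ⊆ T} ⟨?_, ?_, hF⟩
  · refine isClosed_iff_ultrafilter.2 fun θ 𝒰 h𝒰 hT𝒰 => ?_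
    exact (graph_subset_limSet hq ho hs h𝒰).trans
      (Ultrafilter.limSet_subset_of_isClosed hT hT𝒰)
  · intro θ hθ η hη e
    change graph _ ⊆ T
    rw [graph_comp]
    rintro z ⟨y, h1, h2⟩
    exact htrans _ _ _ (hη h1) (hθ h2)

theorem isClosed_equidistant [T2Space L] (hq : Continuous q)
    (P : Set C({z : K × K // q z.1 = q z.2}, ℝ≥0)) : IsClosed (equidistant P) := by
  -- The functions in `P` are defined only on pairs in a common fiber, so closedness is checked in
  -- the closed set `D` and then carried to the ambient space.
  let D : Set ((K × K) × (K × K)) := {w | q w.1.1 = q w.2.1 ∧ q w.1.2 = q w.2.2}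
  have hD : IsClosed D := (isClosed_eq (by fun_prop) (by fun_prop)).inter
    (isClosed_eq (by fun_prop) (by fun_prop))
  have : equidistant P = Subtype.val '' ⋂ p ∈ P,
      {w : D | p ⟨(w.1.1.1, w.1.2.1), w.2.1⟩ = p ⟨(w.1.1.2, w.1.2.2), w.2.2⟩} := by
    ext w
    constructor
    · rintro ⟨e, e', h⟩
      exact ⟨⟨w, e, e'⟩, mem_iInter₂.2 h, rfl⟩
    · rintro ⟨⟨w, e, e'⟩, h, rfl⟩
      exact ⟨e, e', mem_iInter₂.1 h⟩
  rw [this]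
  refine hD.isClosedEmbedding_subtypeVal.isClosedMap _ ?_
  refine isClosed_biInter fun p _ => isClosed_eq ?_ ?_
  · exact p.continuous.comp (Continuous.subtype_mk (by fun_prop) _)
  · exact p.continuous.comp (Continuous.subtype_mk (by fun_prop) _)

section Compact

variable [CompactSpace K] [T2Space K] [CompactSpace L] [T2Space L]

/-- Every ultrafilter of surjective isometries between fibers converges, and the graph of its limit
is the limit of the graphs. -/
theorem exists_limit_surjIsometries (hq : Continuous q) (ho : IsOpenMap q)
    (hP : Separates P) {𝒰 : Ultrafilter (FiberMap q)}
    (h𝒰 : surjIsometries P ∈ 𝒰) :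
    ∃ θ ∈ surjIsometries P, (𝒰 : Filter (FiberMap q)) ≤ 𝓝 θ ∧ 𝒰.limSet graph = θ.graph := by
  obtain ⟨a, -, ha⟩ := isCompact_univ.ultrafilter_le_nhds (𝒰.map src) (by simp)
  obtain ⟨b, -, hb⟩ := isCompact_univ.ultrafilter_le_nhds (𝒰.map tgt) (by simp)
  have ha' : Tendsto (src (q := q)) 𝒰 (𝓝 a) := ha
  have hb' : Tendsto (tgt (q := q)) 𝒰 (𝓝 b) := hb
  have hΓ : 𝒰.limSet graph ×ˢ 𝒰.limSet graph ⊆ equidistant P :=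
    Ultrafilter.limSet_prod_subset_of_isClosed (isClosed_equidistant hq P) (by
      filter_upwards [h𝒰] with θ hθ using hθ.1)
  have hΓa : ∀ z ∈ 𝒰.limSet graph, q z.1 = a := fun z hz =>
    Ultrafilter.eq_of_mem_limSet (hq.comp continuous_fst) ha' (fun θ z hz => q_fst hz) hz
  have hΓb : ∀ z ∈ 𝒰.limSet graph, q z.2 = b := fun z hz =>
    Ultrafilter.eq_of_mem_limSet (hq.comp continuous_snd) hb' (fun θ z hz => q_snd hz) hz
  obtain ⟨θ, hθa, hθb, hθ⟩ := exists_graph_eq hq (𝒰.isClosed_limSet (g := graph)) (a := a) (b := b)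
    (fun z hz => ⟨hΓa z hz, hΓb z hz⟩)
    (by
      rintro x rfl
      -- Full domain: as `q` is open, source fibers close to that of `x` contain points close to
      -- `x`.
      obtain ⟨⟨x', y⟩, hz, rfl⟩ := Ultrafilter.mem_image_limSet (𝒰 := 𝒰) (g := graph)
        (f := Prod.fst) continuous_fst (a := x) (by
          intro N hN
          filter_upwards [ha' (ho.image_mem_nhds hN)] with η hη
          obtain ⟨x', hx', e⟩ := hη
          exact ⟨_, η.mk_mem_graph ⟨x', e⟩, hx'⟩)
      exact ⟨y, hz⟩)
    -- Functionality: the values of `P` at `(x, x)` and at `(y, y')` agree, and the former vanish.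
    (fun x y y' h h' => (hP.eq_iff (hΓ (mk_mem_prod h h'))).1 rfl)
  refine ⟨θ, ⟨?_, ?_⟩, le_nhds_of_limSet_subset hθ.ge, hθ.symm⟩
  · rwa [hθ]
  · rw [hθ, hθb]
    rintro y rfl
    obtain ⟨⟨x, y'⟩, hz, rfl⟩ := Ultrafilter.mem_image_limSet (𝒰 := 𝒰) (g := graph)
      (f := Prod.snd) continuous_snd (a := y) (by
        intro N hN
        filter_upwards [hb' (ho.image_mem_nhds hN), h𝒰] with η hη hη'
        obtain ⟨y', hy', e⟩ := hη
        obtain ⟨x', hx'⟩ := hη'.2 y' e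
        exact ⟨_, hx', hy'⟩)
    exact ⟨x, hz⟩

/-- One limit is a surjective isometry whose graph is the limit of the graphs. The graph of any
other limit is contained in that one, so the two limits coincide. -/
theorem mem_surjIsometries_of_le_nhds (hq : Continuous q) (ho : IsOpenMap q)
    (hs : Function.Surjective q) (hP : Separates P) {𝒰 : Ultrafilter (FiberMap q)}
    (h𝒰 : surjIsometries P ∈ 𝒰) {θ : FiberMap q} (hθ : (𝒰 : Filter (FiberMap q)) ≤ 𝓝 θ) :
    θ ∈ surjIsometries P ∧ 𝒰.limSet graph = θ.graph := by
  obtain ⟨η, hη, -, hη'⟩ := exists_limit_surjIsometries hq ho hP h𝒰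
  have : θ = η := eq_of_graph_subset hs (hη' ▸ graph_subset_limSet hq ho hs hθ)
  rw [this]
  exact ⟨hη, hη'⟩

theorem isClosed_surjIsometries (hq : Continuous q) (ho : IsOpenMap q)
    (hs : Function.Surjective q) (hP : Separates P) : IsClosed (surjIsometries P) :=
  isClosed_iff_ultrafilter.2 fun _ _ h h' =>
    (mem_surjIsometries_of_le_nhds hq ho hs hP h' h).1

theorem isCompact_surjIsometries (hq : Continuous q) (ho : IsOpenMap q)
    (hP : Separates P) : IsCompact (surjIsometries P) :=
  isCompact_iff_ultrafilter_le_nhds'.2 fun _ h =>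
    (exists_limit_surjIsometries hq ho hP h).imp fun _ h => ⟨h.1, h.2.1⟩

/-- For a closed set of surjective isometries, the union of the graphs is closed. -/
theorem isClosed_iUnion_graph (hq : Continuous q) (ho : IsOpenMap q)
    (hP : Separates P) {E : Set (FiberMap q)} (hE : IsClosed E)
    (hEP : E ⊆ surjIsometries P) : IsClosed (⋃ θ ∈ E, graph θ) := by
  refine isClosed_iff_ultrafilter.2 fun z 𝒱 hz h𝒱 => ?_
  have : ∀ w ∈ ⋃ θ ∈ E, graph θ, ∃ θ ∈ E, w ∈ graph θ := fun w hw => by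
    simpa only [mem_iUnion, exists_prop] using hw
  obtain ⟨θ₀, hθ₀, -⟩ := this _ (𝒱.nonempty_of_mem h𝒱).some_mem
  have : Nonempty (FiberMap q) := ⟨θ₀⟩
  -- Choosing a fiber map through each point pushes the ultrafilter on `K × K` forward to fiber
  -- maps, where compactness provides a limit; its graph contains `z`.
  choose! Θ hΘ hΘ' using ‹∀ w ∈ ⋃ θ ∈ E, graph θ, ∃ θ ∈ E, w ∈ graph θ›
  have hE' : E ∈ 𝒱.map Θ := by
    rw [Ultrafilter.mem_map]
    exact Filter.mem_of_superset h𝒱 hΘ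
  obtain ⟨θ, -, hθ, hθ'⟩ := exists_limit_surjIsometries hq ho hP
    (Filter.mem_of_superset hE' hEP)
  refine mem_biUnion (isClosed_iff_ultrafilter.1 hE θ _ hθ hE') ?_
  rw [← hθ']
  intro N hN
  rw [Ultrafilter.coe_map, eventually_map]
  filter_upwards [hz hN, h𝒱] with w hw hw'
  exact ⟨w, hw, hΘ' w hw'⟩

/-- An envelope generated by a symmetric set of surjective isometries that contains all identities
is a groupoid. -/
theorem isFullGroupoid_envelope (hq : Continuous q) (ho : IsOpenMap q)
    (hs : Function.Surjective q) (hP : Separates P) {F : Set (FiberMap q)}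
    (hFP : F ⊆ surjIsometries P) (hid : ∀ l, idOn q l ∈ F)
    (hinv : ∀ θ ∈ F, ∃ η ∈ F, η.graph = Prod.swap ⁻¹' θ.graph) :
    IsFullGroupoid (envelope F) := by
  have hEP : envelope F ⊆ surjIsometries P := envelope_subset
    (isClosed_surjIsometries hq ho hs hP) isSubsemigroupoid_surjIsometries hFP
  have hE : envelope F ⊆
      {θ | θ ∈ surjIsometries P ∧ ∃ η ∈ envelope F, η.graph = Prod.swap ⁻¹' θ.graph} := by
    refine envelope_subset ?_ ?_ ?_
    · refine isClosed_iff_ultrafilter.2 fun θ 𝒰 hθ h𝒰 => ?_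
      have hS : surjIsometries P ∈ 𝒰 := Filter.mem_of_superset h𝒰 fun _ h => h.1
      obtain ⟨hθP, hθ'⟩ := mem_surjIsometries_of_le_nhds hq ho hs hP hS hθ
      refine ⟨hθP, ?_⟩
      -- Inversion as a total function, along which `𝒰` can be pushed forward. Its value `θ'` at
      -- maps without an inverse is arbitrary.
      have : ∀ θ' : FiberMap q, ∃ η : FiberMap q, (θ' ∈ surjIsometries P ∧ ∃ η ∈ envelope F,
          η.graph = Prod.swap ⁻¹' θ'.graph) →
          η ∈ envelope F ∧ η.graph = Prod.swap ⁻¹' θ'.graph := fun θ' => by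
        by_cases h : θ' ∈ surjIsometries P ∧ ∃ η ∈ envelope F,
          η.graph = Prod.swap ⁻¹' θ'.graph
        · exact ⟨h.2.choose, fun _ => h.2.choose_spec⟩
        · exact ⟨θ', fun h' => (h h').elim⟩
      choose I hI using this
      have hE' : envelope F ∈ 𝒰.map I := by
        rw [Ultrafilter.mem_map]
        exact Filter.mem_of_superset h𝒰 fun θ' h => (hI θ' h).1
      obtain ⟨η, -, hη, hη'⟩ := exists_limit_surjIsometries hq ho hP
        (Filter.mem_of_superset hE' hEP)
      refine ⟨η, isClosed_iff_ultrafilter.1 (isClosed_envelope F) η _ hη hE', ?_⟩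
      rw [← hη', ← hθ', ← Homeomorph.coe_prodComm, ← Ultrafilter.limSet_preimage_homeomorph]
      ext z
      refine forall₂_congr fun N _ => ?_
      rw [Ultrafilter.coe_map, eventually_map]
      refine eventually_congr ?_
      filter_upwards [h𝒰] with θ' h
      rw [(hI θ' h).2, Homeomorph.coe_prodComm]
    · rintro θ ⟨hθ, θ', hθ', hθθ'⟩ η ⟨hη, η', hη', hηη'⟩ e
      refine ⟨isSubsemigroupoid_surjIsometries θ hθ η hη e, ?_⟩
      -- Sources and targets of the inverses are read off from the single chain `y ↦ x ↦ θ x`, which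
      -- shows that the inverses compose in the opposite order.
      obtain ⟨x, hx⟩ := hs θ.src
      obtain ⟨y, hy⟩ := hη.2 x (hx.trans e)
      have h1 : (x, y) ∈ η'.graph := by rwa [hηη']
      have h2 : ((θ.map ⟨x, hx⟩ : K), x) ∈ θ'.graph := by
        rw [hθθ']
        exact θ.mk_mem_graph ⟨x, hx⟩
      refine ⟨comp η' θ' ((q_fst h1).symm.trans (q_snd h2)),
        isSubsemigroupoid_envelope F _ hη' _ hθ' _, ?_⟩
      rw [graph_comp, graph_comp, hθθ', hηη']
      ext z
      exact exists_congr fun y => and_comm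
    · intro θ hθ
      obtain ⟨η, hη, hη'⟩ := hinv θ hθ
      exact ⟨hFP hθ, η, subset_envelope F hη, hη'⟩
  refine ⟨isSubsemigroupoid_envelope F, fun l => subset_envelope F (hid l), fun θ hθ => ?_⟩
  obtain ⟨hθP, η, hη, hηθ⟩ := hE hθ
  obtain ⟨x, hx⟩ := hs θ.src
  have h1 := θ.mk_mem_graph ⟨x, hx⟩
  have h2 : ((θ.map ⟨x, hx⟩ : K), x) ∈ η.graph := by
    rw [hηθ]
    exact h1
  have e : η.src = θ.tgt := (q_fst h2).symm.trans (q_snd h1)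
  have e' : θ.src = η.tgt := (q_fst h1).symm.trans (q_snd h2)
  refine ⟨η, hη, e, e', eq_of_graph_subset hs ?_, eq_of_graph_subset hs ?_⟩
  · rw [graph_comp, graph_idOn, hηθ]
    rintro ⟨x, x'⟩ ⟨y, hxy, hx'y⟩
    exact ⟨q_fst (z := (x, y)) hxy, (hP.eq_iff (hθP.1 (mk_mem_prod hxy hx'y))).2 rfl⟩
  · rw [graph_comp, graph_idOn, hηθ]
    rintro ⟨y, y'⟩ ⟨x, hxy, hxy'⟩
    exact ⟨q_snd (z := (x, y)) hxy, graph_functional hxy hxy'⟩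

end Compact

end FiberMap

/-! ### Pseudoisometric actions -/

namespace GroupoidAction

open FiberMap

variable {L : Type w} {G : Type v} [TopologicalSpace L] [TopologicalSpace G]
  {𝒢 : TopologicalGroupoid L G} {K : Type u} [TopologicalSpace K] [CompactSpace K] [T2Space K]

theorem act_congr (A : GroupoidAction 𝒢 K) {g h : G} {x y : K} (hg : g = h) (hx : x = y)
    (e : 𝒢.s g = A.q x) (e' : 𝒢.s h = A.q y) : A.act g x e = A.act h y e' := by
  subst hg hx
  rfl

theorem act_inv_act (A : GroupoidAction 𝒢 K) (g : G) (y : K) (e : 𝒢.s (𝒢.inv g) = A.q y)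
    (e' : 𝒢.s g = A.q (A.act (𝒢.inv g) y e)) : A.act g (A.act (𝒢.inv g) y e) e' = y := by
  have hy : 𝒢.r g = A.q y := (𝒢.s_inv g).symm.trans e
  rw [← A.mul_act g (𝒢.inv g) (𝒢.r_inv g).symm y e]
  exact (A.act_congr ((𝒢.mul_inv g).trans (congrArg 𝒢.unit hy)) rfl _ (𝒢.s_unit _)).trans
    (A.unit_act y)

theorem inv_act_act (A : GroupoidAction 𝒢 K) (g : G) (x : K) (e : 𝒢.s g = A.q x)
    (e' : 𝒢.s (𝒢.inv g) = A.q (A.act g x e)) : A.act (𝒢.inv g) (A.act g x e) e' = x := by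
  rw [← A.mul_act (𝒢.inv g) g (𝒢.s_inv g) x e]
  exact (A.act_congr ((𝒢.inv_mul g).trans (congrArg 𝒢.unit e)) rfl _ (𝒢.s_unit _)).trans
    (A.unit_act x)

theorem mk_mem_graph_transition (A : GroupoidAction 𝒢 K) (g : G) (x : K) (e : 𝒢.s g = A.q x) :
    (x, A.act g x e) ∈ (A.transition g).graph := ⟨e.symm, rfl⟩

theorem graph_transition_inv (A : GroupoidAction 𝒢 K) (g : G) :
    (A.transition (𝒢.inv g)).graph = Prod.swap ⁻¹' (A.transition g).graph := by
  ext ⟨x, y⟩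
  constructor
  · rintro ⟨e, h⟩
    dsimp only at e h
    subst h
    exact ⟨(A.q_act _ _ e.symm).trans (𝒢.r_inv g), A.act_inv_act g x e.symm _⟩
  · rintro ⟨e, h⟩
    dsimp only [Prod.swap] at e h
    subst h
    exact ⟨(A.q_act _ _ e.symm).trans (𝒢.s_inv g).symm, A.inv_act_act g y e.symm _⟩

theorem transition_unit (A : GroupoidAction 𝒢 K) (l : L) :
    A.transition (𝒢.unit l) = idOn A.q l := by
  refine eq_of_graph_subset A.surjective_q ?_
  rw [graph_idOn]
  rintro ⟨x, y⟩ ⟨e, h⟩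
  have hx : A.q x = l := e.trans (𝒢.s_unit l)
  refine ⟨hx, ?_⟩
  subst hx
  exact (A.unit_act x).symm.trans h

/-- The pseudometrics of a pseudoisometric action separate the points of fibers, and the action is by
surjective isometries. -/
theorem IsPseudoisometric.exists_separates {A : GroupoidAction 𝒢 K} (hA : A.IsPseudoisometric) :
    ∃ P : Set C({z : K × K // A.q z.1 = A.q z.2}, ℝ≥0),
      Separates P ∧ range A.transition ⊆ surjIsometries P := by
  obtain ⟨P, hP, htop, hinv⟩ := hA
  refine ⟨P, fun x y e => ⟨?_, fun h => ?_⟩, ?_⟩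
  · rintro rfl p hp
    exact (hP p hp).1 x
  -- By the triangle inequality, points at distance zero have equal distances to every `a`. They lie
  -- in the same generating sets, so they are inseparable in a Hausdorff fiber.
  · have key : ∀ p ∈ P, ∀ a (ea : A.q a = A.q x) (ea' : A.q a = A.q y),
        p ⟨(a, x), ea⟩ = p ⟨(a, y), ea'⟩ := by
      intro p hp a ea ea'
      have h1 := (hP p hp).2.2 a x y ea e
      have h2 := (hP p hp).2.2 a y x ea' e.symm
      rw [h p hp, add_zero] at h1
      rw [← (hP p hp).2.1 x y e, h p hp, add_zero] at h2
      exact le_antisymm h2 h1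
    let X : {a : K // A.q a = A.q x} := ⟨x, rfl⟩
    let Y : {a : K // A.q a = A.q x} := ⟨y, e.symm⟩
    suffices X = Y from congrArg Subtype.val this
    refine Inseparable.eq ?_
    change 𝓝 X = 𝓝 Y
    have hn := fun c => @TopologicalSpace.nhds_generateFrom {a : K // A.q a = A.q x}
      {U | ∃ p ∈ P, ∃ (x₀ : {a : K // A.q a = A.q x}) (ε : ℝ≥0), 0 < ε ∧
          U = {y : {a : K // A.q a = A.q x} | p ⟨(x₀, y), x₀.2.trans y.2.symm⟩ < ε}} c
    rw [← htop (A.q x)] at hn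
    rw [hn, hn]
    refine iInf_congr fun U => iInf_congr_Prop (and_congr_left ?_) fun _ => rfl
    rintro ⟨p, hp, a, ε, -, rfl⟩
    change p ⟨(a, x), _⟩ < ε ↔ p ⟨(a, y), _⟩ < ε
    rw [key p hp a a.2 (a.2.trans e)]
  · rintro _ ⟨g, rfl⟩
    constructor
    · rintro ⟨⟨x, y⟩, ⟨x', y'⟩⟩ ⟨⟨e, h⟩, ⟨e', h'⟩⟩
      dsimp only at e h e' h'
      subst h h'
      exact ⟨e.trans e'.symm, (A.q_act g x e.symm).trans (A.q_act g x' e'.symm).symm, fun p hp =>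
        (hinv p hp g x x' e.symm e'.symm).symm⟩
    · intro y hy
      have e : 𝒢.s (𝒢.inv g) = A.q y := (𝒢.s_inv g).trans hy.symm
      refine ⟨A.act (𝒢.inv g) y e, (A.q_act _ _ e).trans (𝒢.r_inv g), ?_⟩
      exact A.act_inv_act g y e _

/-- A closed transitive relation that contains all pairs `(x, g x)` contains all pairs
`(x, θ(x))` with `θ` in the uniform enveloping semigroupoid. -/
theorem graph_subset_of_mem_uniformEnvelope (A : GroupoidAction 𝒢 K) {T : Set (K × K)}
    (hT : IsClosed T) (htrans : ∀ x y z, (x, y) ∈ T → (y, z) ∈ T → (x, z) ∈ T)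
    (hact : ∀ g x (e : 𝒢.s g = A.q x), (x, A.act g x e) ∈ T) {θ : FiberMap A.q}
    (hθ : θ ∈ A.uniformEnvelope) : θ.graph ⊆ T := by
  refine graph_subset_of_mem_envelope A.continuous_q A.isOpenMap_q A.surjective_q hT htrans ?_ hθ
  rintro _ ⟨g, rfl⟩ ⟨x, y⟩ ⟨e, h⟩
  dsimp only at e h
  subst h
  exact hact g x e.symm

/-- Continuous functions that are invariant under the action are invariant under the uniform
enveloping semigroupoid. -/
theorem eq_of_mem_uniformEnvelope (A : GroupoidAction 𝒢 K) {M : Type*} [TopologicalSpace M]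
    [T2Space M] {f : K → M} (hf : Continuous f)
    (hact : ∀ g x (e : 𝒢.s g = A.q x), f (A.act g x e) = f x) {θ : FiberMap A.q}
    (hθ : θ ∈ A.uniformEnvelope) {x y : K} (hxy : (x, y) ∈ θ.graph) : f x = f y :=
  A.graph_subset_of_mem_uniformEnvelope (T := {z | f z.1 = f z.2})
    (isClosed_eq (by fun_prop) (by fun_prop)) (fun _ _ _ h h' => Eq.trans h h')
    (fun g x e => (hact g x e).symm) hθ hxy

theorem comp_q_eq_of_mem_uniformEnvelope (A : GroupoidAction 𝒢 K) {M : Type*} [TopologicalSpace M]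
    [T2Space M] {f : L → M} (hf : Continuous f) (hact : ∀ g, f (𝒢.s g) = f (𝒢.r g))
    {θ : FiberMap A.q} (hθ : θ ∈ A.uniformEnvelope) {x y : K} (hxy : (x, y) ∈ θ.graph) :
    f (A.q x) = f (A.q y) :=
  A.eq_of_mem_uniformEnvelope (hf.comp A.continuous_q) (fun g x e => by
    simp only [Function.comp_apply, A.q_act, ← hact, e]) hθ hxy

/-! ### Orbit relations of the uniform enveloping groupoid -/

section

variable [CompactSpace L] [T2Space L] {A : GroupoidAction 𝒢 K}

theorem IsPseudoisometric.isFullGroupoid_uniformEnvelope (hA : A.IsPseudoisometric) :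
    IsFullGroupoid A.uniformEnvelope := by
  obtain ⟨P, hP, hF⟩ := hA.exists_separates
  refine isFullGroupoid_envelope A.continuous_q A.isOpenMap_q A.surjective_q hP hF
    (fun l => ⟨_, A.transition_unit l⟩) ?_
  rintro _ ⟨g, rfl⟩
  exact ⟨_, mem_range_self _, A.graph_transition_inv g⟩

theorem uniformEnvelope_subset_surjIsometries {P : Set C({z : K × K // A.q z.1 = A.q z.2}, ℝ≥0)}
    (hP : Separates P) (hF : range A.transition ⊆ surjIsometries P) :
    A.uniformEnvelope ⊆ surjIsometries P :=
  envelope_subset (isClosed_surjIsometries A.continuous_q A.isOpenMap_q A.surjective_q hP)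
    isSubsemigroupoid_surjIsometries hF

theorem IsPseudoisometric.isCompact_uniformEnvelope (hA : A.IsPseudoisometric) :
    IsCompact A.uniformEnvelope := by
  obtain ⟨P, hP, hF⟩ := hA.exists_separates
  exact (isCompact_surjIsometries A.continuous_q A.isOpenMap_q hP).of_isClosed_subset
    (isClosed_envelope _) (uniformEnvelope_subset_surjIsometries hP hF)

theorem IsPseudoisometric.isClosed_iUnion_graph (hA : A.IsPseudoisometric) :
    IsClosed (⋃ θ ∈ A.uniformEnvelope, graph θ) := by
  obtain ⟨P, hP, hF⟩ := hA.exists_separates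
  exact FiberMap.isClosed_iUnion_graph A.continuous_q A.isOpenMap_q hP
    (isClosed_envelope _) (uniformEnvelope_subset_surjIsometries hP hF)

/-- The orbit equivalence relation of the uniform enveloping groupoid. -/
def orbitSetoid (hA : A.IsPseudoisometric) : Setoid K where
  r x y := ∃ θ ∈ A.uniformEnvelope, (x, y) ∈ θ.graph
  iseqv := by
    obtain ⟨hmul, hid, hinv⟩ := hA.isFullGroupoid_uniformEnvelope
    refine ⟨fun x => ⟨_, hid (A.q x), by rw [graph_idOn]; exact ⟨rfl, rfl⟩⟩, ?_, ?_⟩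
    · rintro x y ⟨θ, hθ, hxy⟩
      obtain ⟨η, hη, e, -, h, -⟩ := hinv θ hθ
      have hx : (x, x) ∈ (comp η θ e).graph := by
        rw [h, graph_idOn]
        exact ⟨q_fst (z := (x, y)) hxy, rfl⟩
      rw [graph_comp] at hx
      obtain ⟨y', h1, h2⟩ := hx
      rw [graph_functional hxy h1]
      exact ⟨η, hη, h2⟩
    · rintro x y z ⟨θ, hθ, hxy⟩ ⟨η, hη, hyz⟩
      refine ⟨comp η θ ((q_fst hyz).symm.trans (q_snd hxy)), hmul η hη θ hθ _, ?_⟩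
      rw [graph_comp]
      exact ⟨y, hxy, hyz⟩

/-- The equivalence relation on the unit space induced by the uniform enveloping groupoid. -/
def unitsSetoid (hA : A.IsPseudoisometric) : Setoid L where
  r a b := ∃ x y, A.orbitSetoid hA x y ∧ A.q x = a ∧ A.q y = b
  iseqv := by
    refine ⟨fun a => ?_, ?_, ?_⟩
    · obtain ⟨x, hx⟩ := A.surjective_q a
      exact ⟨x, x, Setoid.refl' _ x, hx, hx⟩
    · rintro a b ⟨x, y, h, hx, hy⟩
      exact ⟨y, x, Setoid.symm' _ h, hy, hx⟩
    · rintro a b c ⟨x, y, ⟨θ, hθ, h⟩, hx, hy⟩ ⟨y', z, ⟨η, hη, h'⟩, hy', hz⟩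
      -- The points `y` and `y'` may differ, but they lie in one fiber, so `η` can be applied to `y`
      -- instead.
      have e : A.q y = η.src := by rw [hy, ← hy', ← q_fst h']
      exact ⟨x, (η.map ⟨y, e⟩ : K), Setoid.trans' _ ⟨θ, hθ, h⟩ ⟨η, hη, η.mk_mem_graph ⟨y, e⟩⟩, hx,
        ((η.map ⟨y, e⟩).2.trans (q_snd h').symm).trans hz⟩

theorem orbitSetoid_act (hA : A.IsPseudoisometric) (g : G) (x : K) (e : 𝒢.s g = A.q x) :
    orbitSetoid hA x (A.act g x e) :=
  ⟨_, subset_envelope _ (mem_range_self g), A.mk_mem_graph_transition g x e⟩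

theorem unitsSetoid_s_r (hA : A.IsPseudoisometric) (g : G) :
    unitsSetoid hA (𝒢.s g) (𝒢.r g) := by
  obtain ⟨x, hx⟩ := A.surjective_q (𝒢.s g)
  exact ⟨x, _, orbitSetoid_act hA g x hx.symm, hx, A.q_act _ _ _⟩

/-- Points over equivalent units can be moved into the same fiber. -/
theorem exists_orbitSetoid_of_unitsSetoid (hA : A.IsPseudoisometric) {x : K} {b : L}
    (h : unitsSetoid hA (A.q x) b) : ∃ y, orbitSetoid hA x y ∧ A.q y = b := by
  obtain ⟨x', y', ⟨θ, hθ, h⟩, hx', rfl⟩ := h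
  have e : A.q x = θ.src := hx'.symm.trans (q_fst h)
  exact ⟨_, ⟨θ, hθ, θ.mk_mem_graph ⟨x, e⟩⟩, (θ.map ⟨x, e⟩).2.trans (q_snd h).symm⟩

theorem isClosed_orbitSetoid (hA : A.IsPseudoisometric) :
    IsClosed {z : K × K | orbitSetoid hA z.1 z.2} := by
  convert hA.isClosed_iUnion_graph using 1
  ext z
  rw [mem_iUnion₂]
  exact ⟨fun ⟨θ, h, h'⟩ => ⟨θ, h, h'⟩, fun ⟨θ, h, h'⟩ => ⟨θ, h, h'⟩⟩

/-- This relation is the image of the compact orbit relation under `q × q`. -/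
theorem isClosed_unitsSetoid (hA : A.IsPseudoisometric) :
    IsClosed {z : L × L | unitsSetoid hA z.1 z.2} := by
  have : {z : L × L | unitsSetoid hA z.1 z.2} =
      Prod.map A.q A.q '' {z : K × K | orbitSetoid hA z.1 z.2} := by
    ext ⟨a, b⟩
    constructor
    · rintro ⟨x, y, h, rfl, rfl⟩
      exact ⟨(x, y), h, rfl⟩
    · rintro ⟨⟨x, y⟩, h, h'⟩
      obtain ⟨rfl, rfl⟩ := Prod.mk.inj h'
      exact ⟨x, y, h, rfl, rfl⟩
  rw [this]
  exact ((isClosed_orbitSetoid hA).isCompact.image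
    (A.continuous_q.prodMap A.continuous_q)).isClosed

instance (hA : A.IsPseudoisometric) : T2Space (Quotient (orbitSetoid hA)) :=
  t2Space_quotient_of_isClosed _ (isClosed_orbitSetoid hA)

instance (hA : A.IsPseudoisometric) : T2Space (Quotient (unitsSetoid hA)) :=
  t2Space_quotient_of_isClosed _ (isClosed_unitsSetoid hA)

/-- The map induced by `q` on orbit spaces. -/
def quotientMap (hA : A.IsPseudoisometric) :
    Quotient (orbitSetoid hA) → Quotient (unitsSetoid hA) :=
  Quotient.map A.q fun x y h => ⟨x, y, h, rfl, rfl⟩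

theorem continuous_quotientMap (hA : A.IsPseudoisometric) : Continuous (quotientMap hA) :=
  A.continuous_q.quotient_map' _

theorem surjective_quotientMap (hA : A.IsPseudoisometric) :
    Function.Surjective (quotientMap hA) := by
  intro b
  obtain ⟨l, rfl⟩ := Quotient.exists_rep b
  obtain ⟨x, rfl⟩ := A.surjective_q l
  exact ⟨⟦x⟧, rfl⟩

theorem isOpenMap_quotientMap (hA : A.IsPseudoisometric) : IsOpenMap (quotientMap hA) := by
  intro U hU
  rw [← (isQuotientMap_quotient_mk' (s := unitsSetoid hA)).isOpen_preimage]
  -- Since points can be moved along orbits into any equivalent fiber, saturating in `L` adds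
  -- nothing to the `q`-image of a saturated set; openness of `q` then suffices.
  have : Quotient.mk (unitsSetoid hA) ⁻¹' (quotientMap hA '' U) =
      A.q '' (Quotient.mk (orbitSetoid hA) ⁻¹' U) := by
    ext l
    constructor
    · rintro ⟨a, ha, h⟩
      obtain ⟨x, rfl⟩ := Quotient.exists_rep a
      obtain ⟨y, hxy, rfl⟩ := exists_orbitSetoid_of_unitsSetoid hA
        (Quotient.exact (s := unitsSetoid hA) h)
      refine ⟨y, ?_, rfl⟩
      have : Quotient.mk (orbitSetoid hA) x = Quotient.mk (orbitSetoid hA) y := Quotient.sound hxy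
      rwa [mem_preimage, ← this]
    · rintro ⟨x, hx, rfl⟩
      exact ⟨⟦x⟧, hx, rfl⟩
  change IsOpen (Quotient.mk (unitsSetoid hA) ⁻¹' _)
  rw [this]
  exact A.isOpenMap_q _ (hU.preimage continuous_quotient_mk')

end

/-! ### Trivial actions and trivial factors -/

variable {M : Type u'} {H : Type w'} [TopologicalSpace M] [CompactSpace M] [T2Space M]
  [TopologicalSpace H] [CompactSpace H] [T2Space H]

/-- The action of the trivial groupoid of `H` given by an open continuous surjection onto `H`. -/
def ofTrivial (t : M → H) (hc : Continuous t) (ho : IsOpenMap t) (hs : Function.Surjective t) :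
    GroupoidAction (trivialGroupoid H) M where
  q := t
  continuous_q := hc
  isOpenMap_q := ho
  surjective_q := hs
  act _ x _ := x
  continuous_act := continuous_snd.comp continuous_subtype_val
  q_act _ _ e := e.symm
  mul_act _ _ _ _ _ := rfl
  unit_act _ := rfl

theorem act_trivial (B : GroupoidAction (trivialGroupoid H) M) (h : H) (x : M)
    (e : (trivialGroupoid H).s h = B.q x) : B.act h x e = x :=
  (B.act_congr (y := x) e rfl e rfl).trans (B.unit_act x)

end GroupoidAction

namespace ActionMorphism

variable {L : Type w} {G : Type v} [TopologicalSpace L] [TopologicalSpace G]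
  {𝒢 : TopologicalGroupoid L G} {K : Type u} [TopologicalSpace K] [CompactSpace K] [T2Space K]
  {A : GroupoidAction 𝒢 K}
  {M : Type u'} {H : Type w'} [TopologicalSpace M] [CompactSpace M] [T2Space M]
  [TopologicalSpace H] [CompactSpace H] [T2Space H]
  {B : GroupoidAction (trivialGroupoid H) M}

/-- Morphisms to trivial actions are given by invariant maps. -/
def ofInvariant (p : K → M) (hp : Continuous p) (φ : L → H) (hφ : Continuous φ)
    (hinv : ∀ g, φ (𝒢.s g) = φ (𝒢.r g)) (hq : ∀ x, B.q (p x) = φ (A.q x))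
    (hact : ∀ g x (e : 𝒢.s g = A.q x), p (A.act g x e) = p x) : ActionMorphism A B where
  p := p
  continuous_p := hp
  Φ :=
    { toFun := fun g => φ (𝒢.s g)
      continuous_toFun := hφ.comp 𝒢.continuous_s
      composable := fun _ h e => (congrArg φ e).trans (hinv h).symm
      map_mul := fun g h e => (congrArg φ (𝒢.s_mul g h e)).trans
        ((hinv h).trans (congrArg φ e.symm)) }
  q_p x := (hq x).trans (congrArg φ (𝒢.s_unit _).symm)
  p_act g x e := (hact g x e).trans (B.act_trivial _ _ _).symm

theorem p_act_eq (f : ActionMorphism A B) (g : G) (x : K) (e : 𝒢.s g = A.q x) :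
    f.p (A.act g x e) = f.p x :=
  (f.p_act g x e).trans (B.act_trivial _ _ _)

theorem toFun_eq_onUnits_s (f : ActionMorphism A B) (g : G) :
    f.Φ.toFun g = f.Φ.onUnits (𝒢.s g) := f.Φ.s_toFun g

/-- The arrows `g` and its inverse are composable, and composable arrows of a trivial groupoid are
equal. -/
theorem onUnits_s_eq_onUnits_r (f : ActionMorphism A B) (g : G) :
    f.Φ.onUnits (𝒢.s g) = f.Φ.onUnits (𝒢.r g) := by
  rw [← 𝒢.s_inv g, ← f.toFun_eq_onUnits_s, ← f.toFun_eq_onUnits_s]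
  exact f.Φ.composable g (𝒢.inv g) (𝒢.r_inv g).symm

theorem continuous_onUnits (f : ActionMorphism A B) : Continuous f.Φ.onUnits :=
  f.Φ.continuous_toFun.comp 𝒢.continuous_unit

/-- Surjectivity makes factor maps epimorphisms; this yields uniqueness in the universal property of
maximal trivial factors. -/
theorem eq_of_comp_eq {K' : Type*} {L' : Type*} {G' : Type*} [TopologicalSpace K'] [CompactSpace K']
    [T2Space K'] [TopologicalSpace L'] [TopologicalSpace G'] {𝒢' : TopologicalGroupoid L' G'}
    {A' : GroupoidAction 𝒢' K'} {f : ActionMorphism A' A} (hf : f.IsFactorMap)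
    {m m' : ActionMorphism A B} (hp : ∀ x, m.p (f.p x) = m'.p (f.p x))
    (hΦ : ∀ g, m.Φ.toFun (f.Φ.toFun g) = m'.Φ.toFun (f.Φ.toFun g)) : m = m' := by
  refine ActionMorphism.ext (funext fun y => ?_) (TopologicalGroupoid.Hom.ext (funext fun h => ?_))
  · obtain ⟨x, rfl⟩ := hf.1 y
    exact hp x
  · obtain ⟨g, rfl⟩ := hf.2 h
    exact hΦ g

end ActionMorphism

/-! ### Orbit spaces as maximal trivial factors -/

namespace GroupoidAction

open ActionMorphism

variable {L : Type w} {G : Type v} [TopologicalSpace L] [TopologicalSpace G] [CompactSpace L]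
  [T2Space L] {𝒢 : TopologicalGroupoid L G} {K : Type u} [TopologicalSpace K] [CompactSpace K]
  [T2Space K] {A : GroupoidAction 𝒢 K}

/-- The trivial action on the orbit space of the uniform enveloping groupoid. -/
def orbitAction (hA : A.IsPseudoisometric) :
    GroupoidAction (trivialGroupoid (Quotient (unitsSetoid hA))) (Quotient (orbitSetoid hA)) :=
  ofTrivial (quotientMap hA) (continuous_quotientMap hA) (isOpenMap_quotientMap hA)
    (surjective_quotientMap hA)

/-- The factor map onto the orbit space. -/
def toOrbitAction (hA : A.IsPseudoisometric) : ActionMorphism A (orbitAction hA) :=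
  ofInvariant (Quotient.mk _) continuous_quotient_mk' (Quotient.mk _) continuous_quotient_mk'
    (fun g => Quotient.sound (unitsSetoid_s_r hA g)) (fun _ => rfl)
    (fun g x e => (Quotient.sound (orbitSetoid_act hA g x e)).symm)

theorem isFactorMap_toOrbitAction (hA : A.IsPseudoisometric) : (toOrbitAction hA).IsFactorMap := by
  refine ⟨Quotient.mk_surjective, fun b => ?_⟩
  obtain ⟨l, rfl⟩ := Quotient.exists_rep b
  exact ⟨𝒢.unit l, congrArg _ (𝒢.s_unit l)⟩

/-- The orbit space of the uniform enveloping groupoid is the maximal trivial factor. -/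
theorem isMaximalTrivialFactor_orbitAction (hA : A.IsPseudoisometric) :
    A.IsMaximalTrivialFactor (orbitAction hA) (toOrbitAction hA) := by
  refine ⟨isFactorMap_toOrbitAction hA, fun M' H' _ _ _ _ _ _ B' f' hf' => ?_⟩
  have hp : ∀ x y, orbitSetoid hA x y → f'.p x = f'.p y := fun x y ⟨θ, hθ, h⟩ =>
    A.eq_of_mem_uniformEnvelope f'.continuous_p f'.p_act_eq hθ h
  have hφ : ∀ a b, unitsSetoid hA a b → f'.Φ.onUnits a = f'.Φ.onUnits b := by
    rintro _ _ ⟨x, y, ⟨θ, hθ, h⟩, rfl, rfl⟩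
    exact A.comp_q_eq_of_mem_uniformEnvelope f'.continuous_onUnits f'.onUnits_s_eq_onUnits_r hθ h
  let m : ActionMorphism (orbitAction hA) B' :=
    ofInvariant (Quotient.lift f'.p hp) (f'.continuous_p.quotient_lift hp)
      (Quotient.lift f'.Φ.onUnits hφ) (f'.continuous_onUnits.quotient_lift hφ) (fun _ => rfl)
      (fun a => by
        obtain ⟨x, rfl⟩ := Quotient.exists_rep a
        exact f'.q_p x)
      (fun _ _ _ => rfl)
  have h1 : ∀ x, m.p ((toOrbitAction hA).p x) = f'.p x := fun x => rfl
  have h2 : ∀ g, m.Φ.toFun ((toOrbitAction hA).Φ.toFun g) = f'.Φ.toFun g := fun g =>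
    (f'.toFun_eq_onUnits_s g).symm
  refine ⟨m, ⟨⟨?_, ?_⟩, h1, h2⟩, fun m' ⟨_, h1', h2'⟩ => ?_⟩
  · exact Function.Surjective.of_comp (g := (toOrbitAction hA).p) hf'.1
  · refine Function.Surjective.of_comp (g := (toOrbitAction hA).Φ.toFun) ?_
    rw [show m.Φ.toFun ∘ (toOrbitAction hA).Φ.toFun = f'.Φ.toFun from funext h2]
    exact hf'.2
  · exact eq_of_comp_eq (isFactorMap_toOrbitAction hA) (fun x => (h1' x).trans (h1 x).symm)
      (fun g => (h2' g).trans (h2 g).symm)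

/-- The trivial action on the quotient of the unit space. -/
def unitsQuotientAction (hA : A.IsPseudoisometric) :
    GroupoidAction (trivialGroupoid (Quotient (unitsSetoid hA))) (Quotient (unitsSetoid hA)) :=
  ofTrivial id continuous_id IsOpenMap.id Function.surjective_id

/-- The factor map of the action on the unit space onto the quotient of the unit space. -/
def toUnitsQuotientAction (hA : A.IsPseudoisometric) :
    ActionMorphism 𝒢.unitAction (unitsQuotientAction hA) :=
  ofInvariant (Quotient.mk _) continuous_quotient_mk' (Quotient.mk _) continuous_quotient_mk'
    (fun g => Quotient.sound (unitsSetoid_s_r hA g)) (fun _ => rfl)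
    (fun g x e => by
      have e : 𝒢.s g = x := e
      subst e
      exact (Quotient.sound (unitsSetoid_s_r hA g)).symm)

theorem isFactorMap_toUnitsQuotientAction (hA : A.IsPseudoisometric) :
    (toUnitsQuotientAction hA).IsFactorMap :=
  ⟨Quotient.mk_surjective, (isFactorMap_toOrbitAction hA).2⟩

theorem p_s_eq_p_r {M : Type u'} {H : Type w'} [TopologicalSpace M] [CompactSpace M] [T2Space M]
    [TopologicalSpace H] [CompactSpace H] [T2Space H] {B : GroupoidAction (trivialGroupoid H) M}
    (f : ActionMorphism 𝒢.unitAction B) (g : G) : f.p (𝒢.s g) = f.p (𝒢.r g) :=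
  (f.p_act_eq g (𝒢.s g) rfl).symm

theorem p_eq_of_unitsSetoid (hA : A.IsPseudoisometric) {M : Type u'} {H : Type w'}
    [TopologicalSpace M] [CompactSpace M] [T2Space M]
    [TopologicalSpace H] [CompactSpace H] [T2Space H] {B : GroupoidAction (trivialGroupoid H) M}
    (f : ActionMorphism 𝒢.unitAction B) {a b : L} (h : unitsSetoid hA a b) : f.p a = f.p b := by
  obtain ⟨x, y, ⟨θ, hθ, h⟩, rfl, rfl⟩ := h
  exact A.comp_q_eq_of_mem_uniformEnvelope f.continuous_p (p_s_eq_p_r f) hθ h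

/-- The quotient of the unit space by the uniform enveloping groupoid is the maximal trivial factor
of the action on the unit space. -/
theorem isMaximalTrivialFactor_unitsQuotientAction (hA : A.IsPseudoisometric) :
    𝒢.unitAction.IsMaximalTrivialFactor (unitsQuotientAction hA) (toUnitsQuotientAction hA) := by
  refine ⟨isFactorMap_toUnitsQuotientAction hA, fun M' H' _ _ _ _ _ _ B' f' hf' => ?_⟩
  have hp : ∀ a b, unitsSetoid hA a b → f'.p a = f'.p b := fun a b => p_eq_of_unitsSetoid hA f'
  have hφ : ∀ a b, unitsSetoid hA a b → f'.Φ.onUnits a = f'.Φ.onUnits b := by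
    rintro _ _ ⟨x, y, ⟨θ, hθ, h⟩, rfl, rfl⟩
    exact A.comp_q_eq_of_mem_uniformEnvelope f'.continuous_onUnits f'.onUnits_s_eq_onUnits_r hθ h
  let m : ActionMorphism (unitsQuotientAction hA) B' :=
    ofInvariant (Quotient.lift f'.p hp) (f'.continuous_p.quotient_lift hp)
      (Quotient.lift f'.Φ.onUnits hφ) (f'.continuous_onUnits.quotient_lift hφ) (fun _ => rfl)
      (fun a => by
        obtain ⟨x, rfl⟩ := Quotient.exists_rep a
        exact f'.q_p x)
      (fun _ _ _ => rfl)
  have h1 : ∀ x, m.p ((toUnitsQuotientAction hA).p x) = f'.p x := fun x => rfl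
  have h2 : ∀ g, m.Φ.toFun ((toUnitsQuotientAction hA).Φ.toFun g) = f'.Φ.toFun g := fun g =>
    (f'.toFun_eq_onUnits_s g).symm
  refine ⟨m, ⟨⟨?_, ?_⟩, h1, h2⟩, fun m' ⟨_, h1', h2'⟩ => ?_⟩
  · exact Function.Surjective.of_comp (g := (toUnitsQuotientAction hA).p) hf'.1
  · refine Function.Surjective.of_comp (g := (toUnitsQuotientAction hA).Φ.toFun) ?_
    rw [show m.Φ.toFun ∘ (toUnitsQuotientAction hA).Φ.toFun = f'.Φ.toFun from funext h2]
    exact hf'.2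
  · exact eq_of_comp_eq (isFactorMap_toUnitsQuotientAction hA)
      (fun x => (h1' x).trans (h1 x).symm) (fun g => (h2' g).trans (h2 g).symm)

/-! ### Ergodicity and transitivity -/

theorem isTransitive_iff (hA : A.IsPseudoisometric) :
    FiberMap.IsTransitive A.uniformEnvelope ↔ Nonempty K ∧ ∀ x y, orbitSetoid hA x y :=
  and_congr_right fun _ => forall_congr' fun _ => eq_univ_iff_forall

theorem isFiberwiseTransitive_iff (hA : A.IsPseudoisometric) :
    FiberMap.IsFiberwiseTransitive A.uniformEnvelope ↔
      ∀ x y, A.q x = A.q y → orbitSetoid hA x y := by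
  constructor
  · intro h x y e
    obtain ⟨θ, hθ, e', -, h⟩ := h (A.q y) ⟨x, e⟩ ⟨y, rfl⟩
    exact ⟨θ, hθ, e.trans e', h⟩
  · intro h l x y
    obtain ⟨θ, hθ, h⟩ := h x y (x.2.trans y.2.symm)
    refine ⟨θ, hθ, x.2.symm.trans (FiberMap.q_fst h), y.2.symm.trans (FiberMap.q_snd h), ?_⟩
    obtain ⟨e, h⟩ := h
    exact h

/-- Ergodicity is tested on the orbit space alone: every trivial factor is constant on orbits. Its
being exactly one point also gives nonemptiness of `K`. -/
theorem isTopologicallyErgodic_iff_isTransitive (hA : A.IsPseudoisometric) :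
    A.IsTopologicallyErgodic ↔ FiberMap.IsTransitive A.uniformEnvelope := by
  rw [isTransitive_iff hA]
  constructor
  · intro h
    obtain ⟨hu⟩ := h _ _ (orbitAction hA) (toOrbitAction hA) (isFactorMap_toOrbitAction hA)
    exact ⟨⟨hu.default.exists_rep.choose⟩,
      fun x y => Quotient.exact (hu.instSubsingleton.elim ⟦x⟧ ⟦y⟧)⟩
  · rintro ⟨⟨x₀⟩, h⟩ M H _ _ _ _ _ _ B f hf
    refine ⟨⟨⟨f.p x₀⟩, fun a => ?_⟩⟩
    obtain ⟨x, rfl⟩ := hf.1 a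
    obtain ⟨θ, hθ, h⟩ := h x x₀
    exact A.eq_of_mem_uniformEnvelope f.continuous_p f.p_act_eq hθ h

/-- The envelope of `K` also controls the action on units: composing invariant maps on `L` with `q`
makes them constant on classes of `unitsSetoid`. -/
theorem isTopologicallyErgodic_groupoid_iff (hA : A.IsPseudoisometric) :
    𝒢.IsTopologicallyErgodic ↔ Nonempty L ∧ ∀ a b, unitsSetoid hA a b := by
  constructor
  · intro h
    obtain ⟨hu⟩ := h _ _ (unitsQuotientAction hA) (toUnitsQuotientAction hA)
      (isFactorMap_toUnitsQuotientAction hA)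
    exact ⟨⟨hu.default.exists_rep.choose⟩,
      fun x y => Quotient.exact (hu.instSubsingleton.elim ⟦x⟧ ⟦y⟧)⟩
  · rintro ⟨⟨a₀⟩, h⟩ M H _ _ _ _ _ _ B f hf
    refine ⟨⟨⟨f.p a₀⟩, fun b => ?_⟩⟩
    obtain ⟨a, rfl⟩ := hf.1 b
    exact p_eq_of_unitsSetoid hA f (h a a₀)

theorem isRelativelyTopologicallyErgodic_iff (hA : A.IsPseudoisometric) :
    A.IsRelativelyTopologicallyErgodic ↔ FiberMap.IsFiberwiseTransitive A.uniformEnvelope := by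
  rw [isFiberwiseTransitive_iff hA]
  constructor
  · rintro ⟨M, H, _, _, _, _, _, _, B, f, N, J, _, _, _, _, _, _, C, g, α, hf, -, hα, -, β, hβ, -⟩
      x y e
    obtain ⟨m, ⟨-, hm, -⟩, -⟩ := hf.2 _ _ (orbitAction hA) (toOrbitAction hA)
      (isFactorMap_toOrbitAction hA)
    -- An isomorphism is injective, so the given maximal trivial factor identifies points of one
    -- fiber; the orbit space, being a factor of it, identifies them too.
    have hxy : f.p x = f.p y := hβ.injective (by rw [hα, hα, e])
    refine Quotient.exact (?_ : (toOrbitAction hA).p x = (toOrbitAction hA).p y)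
    rw [← hm, ← hm, hxy]
  · intro h
    let α : ActionMorphism (orbitAction hA) (unitsQuotientAction hA) :=
      ofInvariant (quotientMap hA) (continuous_quotientMap hA) id continuous_id (fun _ => rfl)
        (fun _ => rfl) (fun _ _ _ => rfl)
    have hinj : Function.Injective (quotientMap hA) := by
      intro a b hab
      obtain ⟨x, rfl⟩ := Quotient.exists_rep a
      obtain ⟨y, rfl⟩ := Quotient.exists_rep b
      -- Move `x` into the fiber of `y`; fiberwise transitivity does the rest.
      obtain ⟨z, hxz, hz⟩ := exists_orbitSetoid_of_unitsSetoid hA (Quotient.exact hab)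
      exact Quotient.sound (Setoid.trans' _ hxz (h z y hz))
    -- Openness of the induced map makes its inverse continuous, as an isomorphism of actions
    -- requires.
    let E := (Equiv.ofBijective _ ⟨hinj, surjective_quotientMap hA⟩).toHomeomorphOfContinuousOpen
      (continuous_quotientMap hA) (isOpenMap_quotientMap hA)
    let β : ActionMorphism (unitsQuotientAction hA) (orbitAction hA) :=
      ofInvariant E.symm E.symm.continuous id continuous_id (fun _ => rfl)
        (fun x => E.apply_symm_apply x) (fun _ _ _ => rfl)
    exact ⟨_, _, _, _, _, _, _, _, orbitAction hA, toOrbitAction hA, _, _, _, _, _, _, _, _,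
      unitsQuotientAction hA, toUnitsQuotientAction hA, α, isMaximalTrivialFactor_orbitAction hA,
      isMaximalTrivialFactor_unitsQuotientAction hA, fun _ => rfl, fun _ => rfl, β,
      E.symm_apply_apply, E.apply_symm_apply, fun _ => rfl, fun _ => rfl⟩

end GroupoidAction

theorem mainTheorem11 {L : Type w} {G : Type v} {K : Type u}
    [TopologicalSpace L] [CompactSpace L] [T2Space L] [TopologicalSpace G]
    [TopologicalSpace K] [CompactSpace K] [T2Space K]
    (𝒢 : TopologicalGroupoid L G) (A : GroupoidAction 𝒢 K) (hA : A.IsPseudoisometric) :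
    (IsCompact A.uniformEnvelope ∧ FiberMap.IsFullGroupoid A.uniformEnvelope) ∧
    (A.IsRelativelyTopologicallyErgodic ↔
      FiberMap.IsFiberwiseTransitive A.uniformEnvelope) ∧
    (A.IsTopologicallyErgodic ↔
      𝒢.IsTopologicallyErgodic ∧ A.IsRelativelyTopologicallyErgodic) ∧
    (A.IsTopologicallyErgodic ↔ FiberMap.IsTransitive A.uniformEnvelope) := by
  refine ⟨⟨hA.isCompact_uniformEnvelope, hA.isFullGroupoid_uniformEnvelope⟩,
    GroupoidAction.isRelativelyTopologicallyErgodic_iff hA, ?_,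
    GroupoidAction.isTopologicallyErgodic_iff_isTransitive hA⟩
  rw [GroupoidAction.isRelativelyTopologicallyErgodic_iff hA,
    GroupoidAction.isTopologicallyErgodic_iff_isTransitive hA,
    GroupoidAction.isTopologicallyErgodic_groupoid_iff hA,
    GroupoidAction.isFiberwiseTransitive_iff hA, GroupoidAction.isTransitive_iff hA]
  constructor
  · rintro ⟨⟨x₀⟩, h⟩
    refine ⟨⟨⟨A.q x₀⟩, fun a b => ?_⟩, fun x y _ => h x y⟩
    obtain ⟨x, rfl⟩ := A.surjective_q a
    obtain ⟨y, rfl⟩ := A.surjective_q b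
    exact ⟨x, y, h x y, rfl, rfl⟩
  · rintro ⟨⟨⟨a₀⟩, h⟩, h'⟩
    refine ⟨⟨(A.surjective_q a₀).choose⟩, fun x y => ?_⟩
    obtain ⟨z, hxz, hz⟩ := GroupoidAction.exists_orbitSetoid_of_unitsSetoid hA (h (A.q x) (A.q y))
    exact Setoid.trans' _ hxz (h' z y hz)
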